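/- Let $(K,v)$ be a valued field, with value group $vK$ and residue field $Kv$ (equivalent valuations are identified). It is called *henselian* if its valuation ring satisfies Hensel's Lemma, and a *defectless field* if for every finite field extension $L|K$ one has $$[L:K]=\sum_{i=1}^{g}(v_iL:vK)\,[Lv_i:Kv],$$ where $v_1,\dots,v_g$ are the distinct extensions of $v$ to $L$. If $\operatorname{char} K=0$, let $v_0$ be the finest coarsening of $v$ whose residue field $Kv_0$ has characteristic $0$; if $\operatorname{char}K>0$, let $v_0$ be the trivial valuation of $K$. Let $v_1$ be the valuation of $Kv_0$ with $v=v_0\circ v_1$, that is, the valuation whose valuation ring is the image of the valuation ring $\mathcal O_v$ under the residue map $\mathcal O_{v_0}\to Kv_0$. The valued field $(Kv_0,v_1)$ is called the *core field* of $(K,v)$. **Proposition.** Let $(K,v)$ be a henselian valued field. Then $(K,v)$ is a defectless field if and only if its core field $(Kv_0,v_1)$ is a defectless field. Moreover, every algebraic extension $(L,w)$ of $(K,v)$ (that is, $L|K$ algebraic and $w$ a valuation of $L$ extending $v$) is a defectless field if and only if every algebraic extension of the core field $(Kv_0,v_1)$ is a defectless field. -/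

import Mathlib

/-!
A valued field `(K, v)` is given by its valuation ring `A : ValuationSubring K`; equivalent
valuations are identified. Its residue field `Kv` is `IsLocalRing.ResidueField A`, its value group
`vK` is `(A.ValueGroup)ˣ` (written multiplicatively), and `(K, v)` is henselian when `A` satisfies
Hensel's Lemma, i.e. `HenselianLocalRing A`. A coarsening of `v` is a `B` with `A ≤ B`.
-/

universe u

open IsLocalRing

noncomputable section

namespace ValuedField

section Extension

variable (K : Type u) {L : Type u} [Field K] [Field L] [Algebra K L]

/-- The restriction to `K` of the valuation of `L` with valuation ring `B`. -/
abbrev restrict (B : ValuationSubring L) : ValuationSubring K :=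
  B.comap (algebraMap K L)

/-- The inclusion of valuation rings `𝒪_K → 𝒪_L`. -/
def integersMap (B : ValuationSubring L) : restrict K B →+* B :=
  (algebraMap K L).restrict (restrict K B) B fun _ hx => hx

instance isLocalHom_integersMap (B : ValuationSubring L) : IsLocalHom (integersMap K B) where
  map_nonunit a ha := by
    rw [ValuationSubring.valuation_eq_one_iff] at ha
    have ha0 : (algebraMap K L a) ≠ 0 := by
      intro h
      have h' : ((integersMap K B a : B) : L) = 0 := h
      rw [h', map_zero] at ha
      exact zero_ne_one ha
    have hinv : (a : K)⁻¹ ∈ restrict K B := by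
      rw [ValuationSubring.mem_comap, map_inv₀, ← ValuationSubring.valuation_le_one_iff, map_inv₀]
      have h' : B.valuation (algebraMap K L a) = 1 := ha
      rw [h', inv_one]
    have hK : (a : K) ≠ 0 := fun h => ha0 (by rw [h, map_zero])
    exact IsUnit.of_mul_eq_one ⟨(a : K)⁻¹, hinv⟩ (Subtype.ext (mul_inv_cancel₀ hK))

/-- The ramification index `(vL : vK)`: the index in `vL` of the image of `Kˣ` under `v`. -/
def ramificationIndex (B : ValuationSubring L) : ℕ :=
  (Units.map ((B.valuation : L →* B.ValueGroup).comp (algebraMap K L : K →* L))).range.index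

/-- The inertia degree `[Lv : Kv]`. -/
def inertiaDegree (B : ValuationSubring L) : ℕ :=
  letI : Algebra (ResidueField (restrict K B)) (ResidueField B) :=
    (ResidueField.map (integersMap K B)).toAlgebra
  Module.finrank (ResidueField (restrict K B)) (ResidueField B)

end Extension

/-- `(K, v)` is a defectless field: for every finite extension `L | K`, equality
`[L : K] = ∑ (vᵢL : vK) [Lvᵢ : Kv]` holds in the fundamental inequality, where the sum runs over
all extensions `vᵢ` of `v` to `L` (there are finitely many, and all summands are finite). -/
def IsDefectlessField {K : Type u} [Field K] (A : ValuationSubring K) : Prop :=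
  ∀ (L : Type u) [Field L] [Algebra K L] [FiniteDimensional K L],
    Module.finrank K L =
      ∑ᶠ B : {B : ValuationSubring L // restrict K B = A},
        ramificationIndex K B.1 * inertiaDegree K B.1

/-- Every algebraic extension of `(K, v)` is a defectless field. -/
def AllAlgebraicExtensionsDefectless {K : Type u} [Field K] (A : ValuationSubring K) : Prop :=
  ∀ (L : Type u) [Field L] [Algebra K L] [Algebra.IsAlgebraic K L] (B : ValuationSubring L),
    restrict K B = A → IsDefectlessField B

section Core

variable {K : Type u} [Field K] (A : ValuationSubring K)

/-- The valuation `v₀`: the finest coarsening of `v` of residue characteristic `0`, its valuation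
ring being the intersection of the valuation rings of all these coarsenings. If `char K > 0`, there
are none, and `v₀` is trivial. -/
def coreCoarsening : ValuationSubring K :=
  A.ofLE (sInf {S | ∃ B : ValuationSubring K,
    A ≤ B ∧ CharZero (ResidueField B) ∧ B.toSubring = S}) <| by
    refine le_sInf ?_
    rintro _ ⟨B, hB, -, rfl⟩
    exact hB

theorem mem_coreCoarsening {x : K} :
    x ∈ coreCoarsening A ↔
      ∀ B : ValuationSubring K, A ≤ B → CharZero (ResidueField B) → x ∈ B := by
  change x ∈ sInf {S | ∃ B : ValuationSubring K,
    A ≤ B ∧ CharZero (ResidueField B) ∧ B.toSubring = S} ↔ _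
  rw [Subring.mem_sInf]
  constructor
  · intro h B hB hc
    exact h _ ⟨B, hB, hc, rfl⟩
  · rintro h _ ⟨B, hB, hc, rfl⟩
    exact h B hB hc

theorem le_coreCoarsening : A ≤ coreCoarsening A :=
  fun _ hx => (mem_coreCoarsening A).2 fun _ hB _ => hB hx

theorem charZero_of_charZero_residueField (B : ValuationSubring K)
    [CharZero (ResidueField B)] : CharZero K where
  cast_injective m n h := by
    have h' : (m : B) = (n : B) := Subtype.ext (by push_cast; exact h)
    have h'' := congrArg (residue B) h'
    rw [map_natCast, map_natCast] at h''
    exact Nat.cast_injective h''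

theorem coreCoarsening_isLeast [CharZero K] :
    IsLeast {B : ValuationSubring K | A ≤ B ∧ CharZero (ResidueField B)} (coreCoarsening A) := by
  refine ⟨⟨le_coreCoarsening A, ?_⟩, fun B hB x hx => (mem_coreCoarsening A).1 hx B hB.1 hB.2⟩
  refine charZero_of_inj_zero fun n hn => ?_
  by_contra hn0
  have hnK : (n : K) ≠ 0 := Nat.cast_ne_zero.2 hn0
  rw [← map_natCast (residue (coreCoarsening A)), residue_eq_zero_iff, mem_maximalIdeal,
    mem_nonunits_iff] at hn
  refine hn (IsUnit.of_mul_eq_one ⟨(n : K)⁻¹, ?_⟩ (Subtype.ext ?_))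
  · refine (mem_coreCoarsening A).2 fun B _ hc => ?_
    have hu : IsUnit (n : B) := by
      rw [← residue_ne_zero_iff_isUnit, map_natCast]
      exact Nat.cast_ne_zero.2 hn0
    obtain ⟨b, hb⟩ := hu.exists_right_inv
    have hb' : (n : K) * b = 1 := by
      have := congrArg (Subtype.val : B → K) hb
      push_cast at this
      exact this
    rw [inv_eq_of_mul_eq_one_right hb']
    exact b.2
  · push_cast
    exact mul_inv_cancel₀ hnK

theorem coreCoarsening_eq_top (h : ¬ CharZero K) : coreCoarsening A = ⊤ := by
  refine top_unique fun x _ => (mem_coreCoarsening A).2 fun B _ _ => ?_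
  exact absurd (charZero_of_charZero_residueField B) h

/-- The underlying field `Kv₀` of the core field of `(K, v)`. -/
abbrev CoreField : Type u := ResidueField (coreCoarsening A)

/-- The valuation `v₁` of the core field `(Kv₀, v₁)` with `v = v₀ ∘ v₁`: its valuation ring is the
image of `𝒪_v` under the residue map of `v₀`. -/
def coreValuation : ValuationSubring (CoreField A) :=
  ValuationSubring.ofSubring
    ((residue (coreCoarsening A)).comp
      (A.inclusion (coreCoarsening A) (le_coreCoarsening A))).range <| by
    intro y
    obtain ⟨x, rfl⟩ := residue_surjective y
    rcases A.mem_or_inv_mem (x : K) with hx | hx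
    · exact Or.inl ⟨⟨x, hx⟩, rfl⟩
    · refine Or.inr ⟨⟨(x : K)⁻¹, hx⟩, ?_⟩
      by_cases h0 : (x : K) = 0
      · have hx0 : x = 0 := Subtype.ext h0
        have : A.inclusion (coreCoarsening A) (le_coreCoarsening A) ⟨(x : K)⁻¹, hx⟩ = 0 :=
          Subtype.ext (by change (x : K)⁻¹ = 0; rw [h0, inv_zero])
        rw [RingHom.comp_apply, this, hx0, map_zero, inv_zero]
      · refine eq_inv_of_mul_eq_one_left ?_
        rw [RingHom.comp_apply, ← map_mul, ← map_one (residue (coreCoarsening A))]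
        exact congrArg _ (Subtype.ext (inv_mul_cancel₀ h0))

/-- `v = v₀ ∘ v₁`, i.e. `𝒪_v = {x ∈ 𝒪_{v₀} : x v₀ ∈ 𝒪_{v₁}}`. -/
theorem mem_iff_residue_mem_coreValuation (x : coreCoarsening A) :
    (x : K) ∈ A ↔ residue (coreCoarsening A) x ∈ coreValuation A := by
  constructor
  · intro hx
    exact ⟨⟨x, hx⟩, rfl⟩
  · rintro ⟨a, ha⟩
    rw [RingHom.comp_apply, ← sub_eq_zero, ← map_sub, residue_eq_zero_iff] at ha
    by_contra hx
    have hx0 : (x : K) ≠ 0 := fun h => hx (h ▸ A.zero_mem)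
    have hxi : (x : K)⁻¹ ∈ A := (A.mem_or_inv_mem (x : K)).resolve_left hx
    have hsub : (a : K) - x ∉ A := fun h => hx (by simpa using A.toSubring.sub_mem a.2 h)
    have hs : ((a : K) - x)⁻¹ ∈ A := (A.mem_or_inv_mem _).resolve_left hsub
    have hs0 : (a : K) - x ≠ 0 := fun h => hsub (h ▸ A.zero_mem)
    rw [mem_maximalIdeal, mem_nonunits_iff] at ha
    exact ha (IsUnit.of_mul_eq_one ⟨_, le_coreCoarsening A hs⟩ (Subtype.ext (mul_inv_cancel₀ hs0)))

end Core

end ValuedField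

end

/-! Write `A₀` for the ring of `v₀`. Two properties of `v₀`, the consequences of
`IsUniqueDefectless`, carry the proof: it extends uniquely to algebraic extensions, and `[L : K] =
e(v₀) [Lv₀ : Kv₀]` for finite `L | K`. The extensions of `v` to `L` are then exactly the composites
of the extension of `v₀` with the extensions of `v₁` to `Lv₀`. Under composition `e` is
multiplicative and `f` is that of the second factor, so both sides of the defect formula for `L | K`
and `v` are `e(v₀)` times those for `Lv₀ | Kv₀` and `v₁` (`defectFormula_iff_residue`). Conversely,
every finite or algebraic extension of `Kv₀` is isomorphic to some `Lv₀` (`exists_finite_lift`,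
`exists_algebraic_lift`). Both properties pass to algebraic extensions of `K`, so the statement
about all of these follows by applying the first equivalence over each `L`.

For trivial `v₀` the two properties are immediate. Otherwise `Kv₀` has characteristic zero.
Uniqueness then rests on `stabilizer_eq_top`: in a finite Galois extension some `β` close to `1` is
fixed by the decomposition group, while its other conjugates have positive value. Hensel's Lemma for
`v` applies to the minimal polynomial of `β` and puts `β` in `K`, so there are no other conjugates
and the decomposition group is everything. Absence of defect is a count of automorphisms
(`finrank_le_of_isGalois`): they act on the residue field, and those acting trivially embed into the
characters of `vN/vK`, because there is no wild ramification. The opposite bound is the fundamental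
inequality, and the normal closure reduces the general case to the Galois one. -/

noncomputable section

namespace ValuedField

/-! ### Restriction of valuations, and multiplicativity of `e` and `f` in towers. -/

section Basic

variable {K L M : Type u} [Field K] [Field L] [Field M] [Algebra K L] [Algebra L M] [Algebra K M]

theorem residue_eq_zero_iff_valuation (B : ValuationSubring L) (x : B) :
    residue B x = 0 ↔ B.valuation x < 1 := by
  rw [residue_eq_zero_iff, ValuationSubring.valuation_lt_one_iff]

theorem residue_eq_residue_iff (B : ValuationSubring L) (x y : B) :
    residue B x = residue B y ↔ B.valuation ((x : L) - y) < 1 := by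
  rw [← sub_eq_zero, ← map_sub, residue_eq_zero_iff_valuation]
  rfl

theorem restrict_restrict [IsScalarTower K L M] (B : ValuationSubring M) :
    restrict K (restrict L B) = restrict K B := by
  ext x
  rw [ValuationSubring.mem_comap, ValuationSubring.mem_comap, ValuationSubring.mem_comap,
    ← IsScalarTower.algebraMap_apply]

theorem mem_restrict {B : ValuationSubring L} {x : K} :
    x ∈ restrict K B ↔ algebraMap K L x ∈ B := Iff.rfl

theorem restrict_valuation_le_iff (B : ValuationSubring L) (x y : K) :
    (restrict K B).valuation x ≤ (restrict K B).valuation y ↔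
      B.valuation (algebraMap K L x) ≤ B.valuation (algebraMap K L y) := by
  by_cases hy : y = 0
  · simp [hy]
  have hy' : algebraMap K L y ≠ 0 := by simpa using hy
  have h1 : (restrict K B).valuation y ≠ 0 := by simpa using hy
  have h2 : B.valuation (algebraMap K L y) ≠ 0 := by simpa using hy
  rw [← div_le_one₀ (zero_lt_iff.2 h1), ← div_le_one₀ (zero_lt_iff.2 h2), ← map_div₀, ← map_div₀,
    ← map_div₀, ValuationSubring.valuation_le_one_iff, ValuationSubring.valuation_le_one_iff]
  rfl

theorem restrict_valuation_lt_iff (B : ValuationSubring L) (x y : K) :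
    (restrict K B).valuation x < (restrict K B).valuation y ↔
      B.valuation (algebraMap K L x) < B.valuation (algebraMap K L y) := by
  rw [← not_le, ← not_le, restrict_valuation_le_iff]

theorem restrict_valuation_eq_iff (B : ValuationSubring L) (x y : K) :
    (restrict K B).valuation x = (restrict K B).valuation y ↔
      B.valuation (algebraMap K L x) = B.valuation (algebraMap K L y) := by
  rw [le_antisymm_iff, le_antisymm_iff, restrict_valuation_le_iff, restrict_valuation_le_iff]

theorem restrict_valuation_lt_one_iff (B : ValuationSubring L) (x : K) :
    (restrict K B).valuation x < 1 ↔ B.valuation (algebraMap K L x) < 1 := by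
  simpa using restrict_valuation_lt_iff B x 1

/-- Chevalley's extension theorem: take a valuation ring of `L` dominating the image of `A`.
Domination excludes `x ∉ A` with image in `B`, since `x⁻¹ ∈ A` would become a unit in `B` and hence
already be a unit in `A`. -/
theorem exists_restrict_eq (L : Type u) [Field L] [Algebra K L] (A : ValuationSubring K) :
    ∃ B : ValuationSubring L, restrict K B = A := by
  obtain ⟨B, hB⟩ := (LocalSubring.map (algebraMap K L) A.toLocalSubring).exists_le_valuationSubring
  obtain ⟨hle, hloc⟩ := hB
  have hmem : ∀ x ∈ A, algebraMap K L x ∈ B := fun x hx => hle ⟨x, hx, rfl⟩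
  refine ⟨B, le_antisymm (fun x hx => ?_) hmem⟩
  rcases A.mem_or_inv_mem x with h | h
  · exact h
  by_cases hx0 : x = 0
  · rw [hx0]; exact A.zero_mem
  have hu : IsUnit (Subring.inclusion hle ⟨algebraMap K L x⁻¹, x⁻¹, h, rfl⟩) := by
    refine IsUnit.of_mul_eq_one ⟨algebraMap K L x, hx⟩ (Subtype.ext ?_)
    change algebraMap K L x⁻¹ * algebraMap K L x = 1
    rw [← map_mul, inv_mul_cancel₀ hx0, map_one]
  obtain ⟨⟨_, y, hy, rfl⟩, hyx⟩ := (hloc.map_nonunit _ hu).exists_right_inv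
  have h1 : algebraMap K L x⁻¹ * algebraMap K L y = 1 := congrArg Subtype.val hyx
  rw [← map_mul, ← map_one (algebraMap K L)] at h1
  have h2 := (algebraMap K L).injective h1
  rw [eq_inv_of_mul_eq_one_right h2, inv_inv] at hy
  exact hy

/-- A valuation ring contains the roots of monic polynomials with coefficients in it. -/
theorem mem_of_monic_of_eval_eq_zero (B : ValuationSubring L) {p : Polynomial L} (hp : p.Monic)
    (hc : ∀ i, p.coeff i ∈ B) {x : L} (hx : p.eval x = 0) : x ∈ B := by
  have hl : p ∈ Polynomial.lifts (algebraMap B L) := by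
    rw [Polynomial.lifts_iff_coeff_lifts]
    exact fun i => ⟨⟨_, hc i⟩, rfl⟩
  obtain ⟨q, hq, -, hqm⟩ := Polynomial.lifts_and_natDegree_eq_and_monic hl hp
  have hint : IsIntegral B x := ⟨q, hqm, by rw [Polynomial.eval₂_eq_eval_map, hq, hx]⟩
  obtain ⟨y, rfl⟩ := IsIntegrallyClosed.isIntegral_iff.1 hint
  exact y.2

/-- The elements of `Lˣ` whose value lies in `vK`. -/
def valueSubgroup (K : Type u) {L : Type u} [Field K] [Field L] [Algebra K L]
    (B : ValuationSubring L) : Subgroup Lˣ :=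
  (Units.map ((B.valuation : L →* B.ValueGroup).comp (algebraMap K L : K →* L))).range.comap
    (Units.map (B.valuation : L →* B.ValueGroup))

theorem mem_valueSubgroup {B : ValuationSubring L} {x : Lˣ} :
    x ∈ valueSubgroup K B ↔ ∃ a : Kˣ, B.valuation x = B.valuation (algebraMap K L a) := by
  rw [valueSubgroup, Subgroup.mem_comap, MonoidHom.mem_range]
  constructor
  · rintro ⟨a, ha⟩
    exact ⟨a, (congrArg Units.val ha).symm⟩
  · rintro ⟨a, ha⟩
    exact ⟨a, Units.ext ha.symm⟩

theorem units_map_valuation_surjective (B : ValuationSubring L) :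
    Function.Surjective (Units.map (B.valuation : L →* B.ValueGroup)) := by
  intro y
  obtain ⟨x, hx⟩ := B.valuation_surjective (y : B.ValueGroup)
  have hx0 : x ≠ 0 := by
    rintro rfl
    exact y.ne_zero (by rw [← hx, map_zero])
  exact ⟨Units.mk0 x hx0, Units.ext hx⟩

theorem ramificationIndex_eq_index (B : ValuationSubring L) :
    ramificationIndex K B = (valueSubgroup K B).index :=
  (Subgroup.index_comap_of_surjective _ (units_map_valuation_surjective B)).symm

/-- The residue field of the restriction to `K`, as a subfield of the residue field of `L`. -/
def residueImage (K : Type u) {L : Type u} [Field K] [Field L] [Algebra K L]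
    (B : ValuationSubring L) : Subfield (ResidueField B) :=
  (ResidueField.map (integersMap K B)).fieldRange

theorem mem_residueImage {B : ValuationSubring L} {y : ResidueField B} :
    y ∈ residueImage K B ↔
      ∃ (a : K) (h : algebraMap K L a ∈ B), residue B ⟨algebraMap K L a, h⟩ = y := by
  rw [residueImage, RingHom.mem_fieldRange]
  constructor
  · rintro ⟨z, rfl⟩
    obtain ⟨a, rfl⟩ := residue_surjective z
    exact ⟨a, a.2, rfl⟩
  · rintro ⟨a, h, rfl⟩
    exact ⟨residue _ ⟨a, h⟩, rfl⟩

theorem finrank_fieldRange {F E : Type u} [Field F] [Field E] [Algebra F E] :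
    Module.finrank F E = Module.finrank (algebraMap F E).fieldRange E :=
  Algebra.finrank_eq_of_equiv_equiv
    (RingEquiv.ofBijective (algebraMap F E).rangeRestrictField
      (algebraMap F E).rangeRestrictField_bijective)
    (RingEquiv.refl E) (by ext; rfl)

/-- With the smaller residue field as a subfield, no algebra structure between residue fields has to
be carried along, and towers are handled by `Subfield.relfinrank`. -/
theorem inertiaDegree_eq_finrank (B : ValuationSubring L) :
    inertiaDegree K B = Module.finrank (residueImage K B) (ResidueField B) := by
  let : Algebra (ResidueField (restrict K B)) (ResidueField B) :=
    (ResidueField.map (integersMap K B)).toAlgebra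
  exact finrank_fieldRange

theorem finrank_eq_of_comap_eq {E E' : Type u} [Field E] [Field E'] (ψ : E ≃+* E')
    (F : Subfield E) (F' : Subfield E') (h : F'.comap (ψ : E →+* E') = F) :
    Module.finrank F E = Module.finrank F' E' := by
  subst h
  rw [Subfield.finrank_comap, ← Subfield.relfinrank_top_right]
  congr 1
  exact RingHom.fieldRange_eq_top_iff.2 ψ.surjective

/-- Multiplicativity of the ramification index in towers. -/
theorem ramificationIndex_tower [IsScalarTower K L M] (B : ValuationSubring M) :
    ramificationIndex K B = ramificationIndex K (restrict L B) * ramificationIndex L B := by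
  rw [ramificationIndex_eq_index, ramificationIndex_eq_index, ramificationIndex_eq_index]
  -- With `H = valueSubgroup K B`, the chain is `H ≤ Lˣ H ≤ Mˣ`: the upper index is `e` of `M | L`,
  -- and the lower one equals `[Lˣ : Lˣ ∩ H]`, which is `e` of `L | K`.
  set φ : Lˣ →* Mˣ := Units.map (algebraMap L M : L →* M)
  have h1 : valueSubgroup K (restrict L B) = (valueSubgroup K B).comap φ := by
    ext x
    rw [Subgroup.mem_comap, mem_valueSubgroup, mem_valueSubgroup]
    refine exists_congr fun a => ?_
    rw [restrict_valuation_eq_iff, ← IsScalarTower.algebraMap_apply]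
    rfl
  have h2 : valueSubgroup L B = φ.range ⊔ valueSubgroup K B := by
    apply le_antisymm
    · intro x hx
      obtain ⟨a, ha⟩ := mem_valueSubgroup.1 hx
      rw [show x = φ a * ((φ a)⁻¹ * x) by group]
      refine Subgroup.mul_mem_sup ⟨a, rfl⟩ (mem_valueSubgroup.2 ⟨1, ?_⟩)
      have h0 : B.valuation (algebraMap L M a) ≠ 0 := by simp
      have : B.valuation ((φ a : M)⁻¹ * x) = 1 := by
        rw [map_mul, map_inv₀, ha]
        exact inv_mul_cancel₀ h0
      simpa using this
    · refine sup_le ?_ ?_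
      · rintro _ ⟨a, rfl⟩
        exact mem_valueSubgroup.2 ⟨a, rfl⟩
      · intro x hx
        obtain ⟨a, ha⟩ := mem_valueSubgroup.1 hx
        exact mem_valueSubgroup.2 ⟨Units.map (algebraMap K L : K →* L) a,
          by rw [ha, IsScalarTower.algebraMap_apply K L M]; rfl⟩
  rw [h1, Subgroup.index_comap, h2, ← Subgroup.relIndex_sup_right,
    Subgroup.relIndex_mul_index le_sup_right]

/-- Multiplicativity of the inertia degree in towers. -/
theorem inertiaDegree_tower [IsScalarTower K L M] (B : ValuationSubring M) :
    inertiaDegree K B = inertiaDegree K (restrict L B) * inertiaDegree L B := by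
  rw [inertiaDegree_eq_finrank, inertiaDegree_eq_finrank, inertiaDegree_eq_finrank]
  have hle : residueImage K B ≤ residueImage L B := by
    intro y hy
    obtain ⟨a, h, rfl⟩ := mem_residueImage.1 hy
    have h' := h
    rw [IsScalarTower.algebraMap_apply K L M] at h'
    exact mem_residueImage.2 ⟨algebraMap K L a, h', congrArg _ (Subtype.ext
      (IsScalarTower.algebraMap_apply K L M a).symm)⟩
  have h1 : residueImage K (restrict L B) =
      (residueImage K B).comap (ResidueField.map (integersMap L B)) := by
    ext y
    obtain ⟨y, rfl⟩ := residue_surjective y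
    rw [Subfield.mem_comap, mem_residueImage, mem_residueImage]
    refine exists_congr fun a => ?_
    have hiff : algebraMap K L a ∈ restrict L B ↔ algebraMap K M a ∈ B := by
      rw [mem_restrict, ← IsScalarTower.algebraMap_apply]
    have key : ∀ h h', residue (restrict L B) ⟨algebraMap K L a, h⟩ = residue _ y ↔
        residue B ⟨algebraMap K M a, h'⟩ =
          ResidueField.map (integersMap L B) (residue _ y) := by
      intro h h'
      rw [residue_eq_residue_iff, ResidueField.map_residue, residue_eq_residue_iff,
        restrict_valuation_lt_one_iff, map_sub, ← IsScalarTower.algebraMap_apply]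
      rfl
    exact ⟨fun ⟨h, e⟩ => ⟨hiff.1 h, (key _ _).1 e⟩, fun ⟨h, e⟩ => ⟨hiff.2 h, (key _ _).2 e⟩⟩
  rw [h1, Subfield.finrank_comap, ← Subfield.relfinrank_mul_finrank_top hle]
  rfl

end Basic

/-! ### The inequality `e f ≤ [L : K]` for one extension. -/

section FundamentalInequality

variable {K L : Type u} [Field K] [Field L] [Algebra K L]

/-- The Gauss norm formula for elements with linearly independent residues. -/
theorem valuation_sum_smul {ι : Type*} (B : ValuationSubring L) (t : ι → B)
    (ht : LinearIndependent (residueImage K B) fun i => residue B (t i)) (s : Finset ι)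
    (a : ι → K) {j : ι} (hj : j ∈ s)
    (hmax : ∀ i ∈ s, B.valuation (algebraMap K L (a i)) ≤ B.valuation (algebraMap K L (a j))) :
    B.valuation (∑ i ∈ s, a i • (t i : L)) = B.valuation (algebraMap K L (a j)) := by
  by_cases h0 : a j = 0
  · have : ∀ i ∈ s, a i = 0 := fun i hi => by simpa [h0] using hmax i hi
    rw [Finset.sum_eq_zero fun i hi => by rw [this i hi, zero_smul], h0, map_zero, map_zero,
      map_zero]
  have h0' : B.valuation (algebraMap K L (a j)) ≠ 0 := by simpa using h0
  -- Dividing by the coefficient of largest value makes all coefficients integral and the `j`-th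
  -- equal to `1`. If the normalized sum had residue zero, independence would force the residue of
  -- that `1` to vanish.
  have hb : ∀ i ∈ s, algebraMap K L (a i / a j) ∈ B := fun i hi => by
    rw [← ValuationSubring.valuation_le_one_iff, map_div₀, map_div₀,
      div_le_one₀ (zero_lt_iff.2 h0')]
    exact hmax i hi
  classical
  let b : ι → B := fun i => if h : i ∈ s then ⟨algebraMap K L (a i / a j), hb i h⟩ else 0
  have hbi : ∀ i ∈ s, (b i : L) = algebraMap K L (a i / a j) := fun i hi => by simp [b, hi]
  have hbr : ∀ i, residue B (b i) ∈ residueImage K B := by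
    intro i
    by_cases hi : i ∈ s
    · exact mem_residueImage.2 ⟨a i / a j, hb i hi, congrArg _ (Subtype.ext (hbi i hi).symm)⟩
    · simp [b, hi]
  have hne : residue B (∑ i ∈ s, b i * t i) ≠ 0 := by
    intro h
    rw [map_sum] at h
    have := linearIndependent_iff'.1 ht s (fun i => ⟨residue B (b i), hbr i⟩) (by
      rw [← h]
      refine Finset.sum_congr rfl fun i _ => ?_
      rw [map_mul]
      rfl) j hj
    have h1 : residue B (b j) = 0 := congrArg Subtype.val this
    have h2 : b j = 1 := Subtype.ext (by rw [hbi j hj, div_self h0, map_one]; rfl)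
    rw [h2, map_one] at h1
    exact one_ne_zero h1
  have hu := (ValuationSubring.valuation_eq_one_iff _ _).1 ((residue_ne_zero_iff_isUnit _).1 hne)
  have hsum : ∑ i ∈ s, a i • (t i : L) =
      algebraMap K L (a j) * ((∑ i ∈ s, b i * t i : B) : L) := by
    push_cast
    rw [Finset.mul_sum]
    refine Finset.sum_congr rfl fun i hi => ?_
    rw [hbi i hi, ← mul_assoc, ← map_mul, mul_div_cancel₀ _ h0, Algebra.smul_def]
  rw [hsum, map_mul, hu, mul_one]

/-- By `valuation_sum_smul`, each inner sum over `κ` that is nonzero has its value in `vK`.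
Multiplying by the `s i`, which represent distinct classes modulo `vK`, gives terms of pairwise
distinct values; the largest one dominates, so the total cannot vanish. -/
theorem linearIndependent_mul {ι κ : Type*} (B : ValuationSubring L) (s : ι → Lˣ)
    (hs : ∀ i j, (s i)⁻¹ * s j ∈ valueSubgroup K B → i = j) (t : κ → B)
    (ht : LinearIndependent (residueImage K B) fun i => residue B (t i)) :
    LinearIndependent K fun p : ι × κ => (s p.1 : L) * t p.2 := by
  classical
  rw [linearIndependent_iff']
  intro S a hS
  by_contra! hne
  obtain ⟨⟨i₀, j₀⟩, h₀, ha₀⟩ := hne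
  let P := S.image Prod.fst
  let Q := S.image Prod.snd
  -- Extending the coefficients by zero from `S` to the rectangle `P × Q` allows summation row by
  -- row.
  let b : ι × κ → K := fun p => if p ∈ S then a p else 0
  let u : ι → L := fun i => ∑ j ∈ Q, b (i, j) • (t j : L)
  have hQ : Q.Nonempty := ⟨j₀, Finset.mem_image.2 ⟨_, h₀, rfl⟩⟩
  have hP : P.Nonempty := ⟨i₀, Finset.mem_image.2 ⟨_, h₀, rfl⟩⟩
  have hsum : ∑ i ∈ P, (s i : L) * u i = 0 := by
    rw [← hS]
    simp only [u, Finset.mul_sum]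
    rw [← Finset.sum_product', ← Finset.sum_subset (s₁ := S)]
    · exact Finset.sum_congr rfl fun p hp => by simp [b, hp]
    · exact fun p hp => Finset.mem_product.2
        ⟨Finset.mem_image_of_mem _ hp, Finset.mem_image_of_mem _ hp⟩
    · intro p _ hp
      simp [b, hp]
  have huv : ∀ i, ∃ j ∈ Q, B.valuation (u i) = B.valuation (algebraMap K L (b (i, j))) ∧
      ∀ k ∈ Q, B.valuation (algebraMap K L (b (i, k))) ≤ B.valuation (u i) := by
    intro i
    obtain ⟨j, hj, hm⟩ := Q.exists_max_image (fun j => B.valuation (algebraMap K L (b (i, j)))) hQ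
    have := valuation_sum_smul B t ht Q (fun j => b (i, j)) hj hm
    exact ⟨j, hj, this, fun k hk => (hm k hk).trans this.ge⟩
  have hu₀ : B.valuation (u i₀) ≠ 0 := by
    obtain ⟨j, -, -, hm⟩ := huv i₀
    intro h
    have := hm j₀ (Finset.mem_image.2 ⟨_, h₀, rfl⟩)
    rw [h] at this
    simp [b, h₀, ha₀] at this
  obtain ⟨i, hi, hm⟩ := P.exists_max_image (fun i => B.valuation ((s i : L) * u i)) hP
  have hui : B.valuation ((s i : L) * u i) ≠ 0 := by
    have := hm i₀ (Finset.mem_image.2 ⟨_, h₀, rfl⟩)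
    refine (lt_of_lt_of_le (zero_lt_iff.2 ?_) this).ne'
    rw [map_mul]
    exact mul_ne_zero (by simp) hu₀
  have hlt : ∀ k ∈ P \ {i}, B.valuation ((s k : L) * u k) < B.valuation ((s i : L) * u i) := by
    intro k hk
    rw [Finset.mem_sdiff, Finset.mem_singleton] at hk
    refine lt_of_le_of_ne (hm k hk.1) fun heq => hk.2 (hs _ _ ?_)
    obtain ⟨ji, -, hji, -⟩ := huv i
    obtain ⟨jk, -, hjk, -⟩ := huv k
    rw [mem_valueSubgroup]
    rw [map_mul, map_mul, hji, hjk] at heq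
    rw [map_mul, hji] at hui
    have h1 : b (i, ji) ≠ 0 := fun h => hui (by rw [h]; simp)
    have h2 : b (k, jk) ≠ 0 := fun h => hui (by rw [← heq, h]; simp)
    refine ⟨Units.mk0 (b (k, jk) / b (i, ji)) (div_ne_zero h2 h1), ?_⟩
    rw [Units.val_mul, Units.val_inv_eq_inv_val, map_mul, map_inv₀, Units.val_mk0, map_div₀,
      map_div₀, eq_div_iff (by simpa using h1), mul_assoc, ← heq, inv_mul_cancel_left₀]
    simp
  rw [← Valuation.map_sum_eq_of_lt _ hi hlt, hsum, map_zero] at hui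
  exact hui rfl

theorem exists_residue_basis (B : ValuationSubring L) :
    ∃ (κ : Type u) (t : κ → B), LinearIndependent (residueImage K B) (fun i => residue B (t i)) ∧
      Nat.card κ = inertiaDegree K B ∧ Nonempty κ := by
  let b := Module.Free.chooseBasis (residueImage K B) (ResidueField B)
  choose t ht using fun i => residue_surjective (b i)
  refine ⟨_, t, ?_, ?_, b.index_nonempty⟩
  · simp only [ht]
    exact b.linearIndependent
  · rw [inertiaDegree_eq_finrank, Module.finrank_eq_nat_card_basis b]

/-- The fundamental inequality for a single extension of valuations. -/
theorem fundamental_inequality [FiniteDimensional K L] (B : ValuationSubring L) :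
    ramificationIndex K B ≠ 0 ∧ inertiaDegree K B ≠ 0 ∧
      ramificationIndex K B * inertiaDegree K B ≤ Module.finrank K L := by
  obtain ⟨κ, t, ht, hκ, hne⟩ := exists_residue_basis (K := K) B
  have hli := linearIndependent_mul (K := K) B
    (fun q : Lˣ ⧸ valueSubgroup K B => q.out) (fun i j h => by
      rw [← QuotientGroup.eq, QuotientGroup.out_eq', QuotientGroup.out_eq'] at h
      exact h) t ht
  have hfin : Finite ((Lˣ ⧸ valueSubgroup K B) × κ) := hli.finite
  -- `Subgroup.index` and `Nat.card` are `0` for infinite sets, so finiteness of both factors is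
  -- needed; it follows from that of the product, as neither factor is empty.
  have h1 : Finite (Lˣ ⧸ valueSubgroup K B) := Finite.prod_left κ
  have h2 : Finite κ := Finite.prod_right (Lˣ ⧸ valueSubgroup K B)
  rw [← hκ, ramificationIndex_eq_index, Subgroup.index, ← Nat.card_prod]
  refine ⟨Nat.card_pos.ne', Nat.card_pos.ne', ?_⟩
  have := Fintype.ofFinite ((Lˣ ⧸ valueSubgroup K B) × κ)
  rw [Nat.card_eq_fintype_card]
  exact hli.fintype_card_le_finrank

end FundamentalInequality

/-! ### Products near `0` or `1`, and integers in residue characteristic zero. -/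

section Valuation

variable {K : Type u} [Field K]

theorem valuation_prod_sub_one_lt {ι : Type*} (B : ValuationSubring K) (s : Finset ι) (f : ι → K)
    (hf : ∀ i ∈ s, B.valuation (f i - 1) < 1) : B.valuation (∏ i ∈ s, f i - 1) < 1 := by
  have h : ∀ i ∈ s, f i ∈ B := fun i hi => by
    rw [← ValuationSubring.valuation_le_one_iff, ← sub_add_cancel (f i) 1]
    exact B.valuation.map_add_le (hf i hi).le (by rw [map_one])
  classical
  induction s using Finset.induction_on with
  | empty => simp
  | insert a s ha ih =>
    rw [Finset.prod_insert ha,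
      show f a * ∏ i ∈ s, f i - 1 = f a * (∏ i ∈ s, f i - 1) + (f a - 1) by ring]
    refine B.valuation.map_add_lt ?_ (hf a (Finset.mem_insert_self a s))
    rw [map_mul]
    exact mul_lt_one_of_nonneg_of_lt_one_right
      ((B.valuation_le_one_iff _).2 (h a (Finset.mem_insert_self a s))) zero_le
      (ih (fun i hi => hf i (Finset.mem_insert_of_mem hi))
        fun i hi => h i (Finset.mem_insert_of_mem hi))

theorem valuation_prod_lt_one {ι : Type*} (B : ValuationSubring K) (s : Finset ι) (f : ι → K)
    (hf : ∀ i ∈ s, f i ∈ B) {j : ι} (hj : j ∈ s) (hlt : B.valuation (f j) < 1) :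
    B.valuation (∏ i ∈ s, f i) < 1 := by
  classical
  rw [← Finset.mul_prod_erase s f hj, map_mul]
  refine mul_lt_one_of_nonneg_of_lt_one_left zero_le hlt ?_
  rw [ValuationSubring.valuation_le_one_iff]
  exact prod_mem fun i hi => hf i (Finset.mem_of_mem_erase hi)

theorem valuation_natCast (B : ValuationSubring K) [CharZero (ResidueField B)] {n : ℕ}
    (hn : n ≠ 0) : B.valuation (n : K) = 1 := by
  have h : residue B (n : B) ≠ 0 := by
    rw [map_natCast]
    exact Nat.cast_ne_zero.2 hn
  have := (ValuationSubring.valuation_eq_one_iff _ _).1 ((residue_ne_zero_iff_isUnit _).1 h)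
  simpa using this

/-- For finitely many elements `c i`, some positive integer is incongruent to all `-c i`. -/
theorem exists_natCast_add_valuation_ge_one (B : ValuationSubring K) [CharZero (ResidueField B)]
    {ι : Type*} [Finite ι] (c : ι → K) :
    ∃ n : ℕ, n ≠ 0 ∧ ∀ i, 1 ≤ B.valuation (n + c i) := by
  have hfin : {n : ℕ | ∃ i, B.valuation (n + c i) < 1}.Finite := by
    rw [Set.ofPred_exists]
    -- Each `c i` excludes at most one `n`: two excluded numbers would differ by a nonzero integer
    -- of value `< 1`, whereas nonzero integers have value `1`.
    refine Set.finite_iUnion fun i => Set.Subsingleton.finite ?_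
    intro m hm n hn
    by_contra hne
    wlog hlt : m < n generalizing m n
    · exact this hn hm (Ne.symm hne) (lt_of_le_of_ne (not_lt.1 hlt) (Ne.symm hne))
    have h1 := valuation_natCast B (Nat.sub_ne_zero_of_lt hlt)
    have h2 := B.valuation.map_sub_lt hn hm
    rw [add_sub_add_right_eq_sub, ← Nat.cast_sub hlt.le, h1] at h2
    exact lt_irrefl _ h2
  obtain ⟨n, hn⟩ := (hfin.union (Set.finite_singleton 0)).exists_notMem
  simp only [Set.mem_union, Set.mem_ofPred_eq, Set.mem_singleton_iff, not_or, not_exists,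
    not_lt] at hn
  exact ⟨n, hn.2, hn.1⟩

end Valuation

/-! ### The decomposition group is everything when a refinement of the base valuation is henselian.
-/

section Invariance

variable {K N : Type u} [Field K] [Field N] [Algebra K N]

/-- The automorphisms mapping the valuation ring into itself. -/
def stabilizer (K : Type u) {N : Type u} [Field K] [Field N] [Algebra K N] [FiniteDimensional K N]
    (W : ValuationSubring N) : Subgroup (N ≃ₐ[K] N) where
  carrier := {σ | ∀ x ∈ W, σ x ∈ W}
  one_mem' := fun _ hx => hx
  mul_mem' := fun ha hb x hx => ha _ (hb x hx)
  inv_mem' := by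
    intro σ hσ
    have hpow : ∀ n : ℕ, ∀ x ∈ W, (σ ^ n) x ∈ W := by
      intro n
      induction n with
      | zero => exact fun _ hx => hx
      | succ n ih =>
        intro x hx
        rw [pow_succ]
        exact ih _ (hσ x hx)
    obtain ⟨n, hn⟩ : σ⁻¹ ∈ Submonoid.powers σ := by
      have := isOfFinOrder_of_finite σ
      rw [this.mem_powers_iff_mem_zpowers]
      exact Subgroup.inv_mem _ (Subgroup.mem_zpowers σ)
    intro x hx
    rw [← hn]
    exact hpow n x hx

variable [FiniteDimensional K N]

theorem mem_stabilizer {W : ValuationSubring N} {σ : N ≃ₐ[K] N} :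
    σ ∈ stabilizer K W ↔ ∀ x ∈ W, σ x ∈ W := Iff.rfl

theorem apply_mem_iff {W : ValuationSubring N} {σ : N ≃ₐ[K] N} (hσ : σ ∈ stabilizer K W) (x : N) :
    σ x ∈ W ↔ x ∈ W := by
  refine ⟨fun h => ?_, hσ x⟩
  have := (stabilizer K W).inv_mem hσ _ h
  rwa [← AlgEquiv.mul_apply, inv_mul_cancel, AlgEquiv.one_apply] at this

theorem valuation_apply_lt_one_iff {W : ValuationSubring N} {σ : N ≃ₐ[K] N}
    (hσ : σ ∈ stabilizer K W) (x : N) : W.valuation (σ x) < 1 ↔ W.valuation x < 1 := by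
  rw [← ValuationSubring.mem_nonunits_iff, ← ValuationSubring.mem_nonunits_iff,
    ValuationSubring.mem_nonunits_iff_or, ValuationSubring.mem_nonunits_iff_or, ← map_inv₀,
    apply_mem_iff hσ, map_eq_zero]

theorem exists_separating_element (W : ValuationSubring N) [CharZero (ResidueField W)]
    {τ : N ≃ₐ[K] N} (hτ : τ ∉ stabilizer K W) :
    ∃ β : N, W.valuation (β - 1) < 1 ∧ W.valuation (τ β) < 1 ∧ ∀ ρ : N ≃ₐ[K] N, ρ β ∈ W := by
  obtain ⟨x, hx, hτx⟩ : ∃ x ∈ W, τ x ∉ W := by simpa [mem_stabilizer] using hτ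
  obtain ⟨y, hy, hτy⟩ : ∃ y ∈ W, τ⁻¹ y ∉ W := by
    have : τ⁻¹ ∉ stabilizer K W := fun h => hτ (inv_mem_iff.1 h)
    simpa only [mem_stabilizer, not_forall, exists_prop] using this
  rw [← ValuationSubring.valuation_le_one_iff] at hx hτx hy hτy
  rw [not_le] at hτx hτy
  have hx0 : x ≠ 0 := by
    rintro rfl
    simp at hτx
  have hvx : W.valuation x ≠ 0 := by simpa using hx0
  have hvτx : W.valuation (τ x) ≠ 0 := by simpa using hx0
  -- This `c` is large while `τ c` is small. The map `c ↦ c / (n + c)` sends large elements close to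
  -- `1` and small ones close to `0`; the choice of `n` keeps every denominator `n + ρ c` of value
  -- at least `1`, so all conjugates of the quotient are integral.
  set c := τ⁻¹ y / x with hc
  have hc1 : 1 < W.valuation c := by
    rw [hc, map_div₀, one_lt_div₀ (zero_lt_iff.2 hvx)]
    exact hx.trans_lt hτy
  have hτc : W.valuation (τ c) < 1 := by
    rw [hc, map_div₀, ← AlgEquiv.mul_apply, mul_inv_cancel, AlgEquiv.one_apply, map_div₀,
      div_lt_one₀ (zero_lt_iff.2 hvτx)]
    exact hy.trans_lt hτx
  obtain ⟨n, hn0, hn⟩ := exists_natCast_add_valuation_ge_one W fun ρ : N ≃ₐ[K] N => ρ c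
  have hvn := valuation_natCast W hn0
  have hne : ∀ ρ : N ≃ₐ[K] N, (n : N) + ρ c ≠ 0 := by
    intro ρ h
    have := hn ρ
    rw [h, map_zero] at this
    exact not_lt_of_ge this zero_lt_one
  have hpos : ∀ ρ : N ≃ₐ[K] N, 0 < W.valuation (n + ρ c) := fun ρ => zero_lt_one.trans_le (hn ρ)
  have hρ : ∀ ρ : N ≃ₐ[K] N, ρ (c / (n + c)) = ρ c / (n + ρ c) := by
    intro ρ
    rw [map_div₀, map_add, map_natCast]
  refine ⟨c / (n + c), ?_, ?_, fun ρ => ?_⟩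
  · have h1 : W.valuation (n + c) = W.valuation c :=
      W.valuation.map_add_eq_of_lt_right (hvn.trans_lt hc1)
    have h2 : (n : N) + c ≠ 0 := hne 1
    rw [show c / (n + c) - 1 = -(n / (n + c)) by field_simp; ring, Valuation.map_neg, map_div₀, h1,
      hvn, div_lt_one₀ (zero_lt_one.trans hc1)]
    exact hc1
  · rw [hρ, map_div₀, div_lt_one₀ (hpos τ)]
    exact hτc.trans_le (hn τ)
  · rw [hρ, ← ValuationSubring.valuation_le_one_iff, map_div₀, div_le_one₀ (hpos ρ)]
    rcases le_or_gt (W.valuation (ρ c)) 1 with h | h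
    · exact h.trans (hn ρ)
    · exact (W.valuation.map_add_eq_of_lt_right (hvn.trans_lt h)).ge

/-- Multiplying the separating elements for all `τ` outside the stabilizer gives one that works for
every such `τ` at once; the product of its conjugates under the stabilizer is invariant. Integrality
of all conjugates keeps the remaining factors harmless. -/
theorem exists_stabilizer_invariant_element (W : ValuationSubring N) [CharZero (ResidueField W)] :
    ∃ β : N, W.valuation (β - 1) < 1 ∧ (∀ τ ∉ stabilizer K W, W.valuation (τ β) < 1) ∧
      ∀ σ ∈ stabilizer K W, σ β = β := by
  classical
  have hsep : ∀ τ : N ≃ₐ[K] N, ∃ β : N, W.valuation (β - 1) < 1 ∧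
      (τ ∉ stabilizer K W → W.valuation (τ β) < 1) ∧ ∀ ρ : N ≃ₐ[K] N, ρ β ∈ W := by
    intro τ
    by_cases hτ : τ ∈ stabilizer K W
    · exact ⟨1, by simp, fun h => absurd hτ h, fun ρ => by rw [map_one]; exact W.one_mem⟩
    · obtain ⟨β, h1, h2, h3⟩ := exists_separating_element W hτ
      exact ⟨β, h1, fun _ => h2, h3⟩
  choose β h1 h2 h3 using hsep
  have := Fintype.ofFinite (stabilizer K W)
  have hmem : ∀ ρ : N ≃ₐ[K] N, ρ (∏ τ, β τ) ∈ W := fun ρ => by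
    rw [map_prod]
    exact prod_mem fun τ _ => h3 τ ρ
  have hlt : ∀ τ ∉ stabilizer K W, W.valuation (τ (∏ τ, β τ)) < 1 := fun τ hτ => by
    rw [map_prod]
    exact valuation_prod_lt_one W _ _ (fun ρ _ => h3 ρ τ) (Finset.mem_univ τ) (h2 τ hτ)
  refine ⟨∏ σ : stabilizer K W, (σ : N ≃ₐ[K] N) (∏ τ, β τ), ?_, fun τ hτ => ?_, fun σ hσ => ?_⟩
  · refine valuation_prod_sub_one_lt W _ _ fun σ _ => ?_
    rw [← map_one (σ : N ≃ₐ[K] N), ← map_sub, valuation_apply_lt_one_iff σ.2]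
    exact valuation_prod_sub_one_lt W _ _ fun τ _ => h1 τ
  · rw [map_prod]
    refine valuation_prod_lt_one W _ _ (fun σ _ => ?_) (Finset.mem_univ 1) ?_
    · rw [← AlgEquiv.mul_apply]
      exact hmem _
    · rw [← AlgEquiv.mul_apply]
      exact hlt _ (by simpa using hτ)
  · rw [map_prod]
    exact Fintype.prod_equiv (Equiv.mulLeft (⟨σ, hσ⟩ : stabilizer K W)) _ _ fun τ => rfl

/-- Integers up to elements of positive value. -/
def intAddNonunits (W : ValuationSubring N) : Subring N where
  carrier := {x | ∃ k : ℤ, W.valuation (x - k) < 1}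
  zero_mem' := ⟨0, by simp⟩
  one_mem' := ⟨1, by simp⟩
  add_mem' := by
    rintro x y ⟨k, hk⟩ ⟨l, hl⟩
    refine ⟨k + l, ?_⟩
    push_cast
    rw [add_sub_add_comm]
    exact W.valuation.map_add_lt hk hl
  neg_mem' := by
    rintro x ⟨k, hk⟩
    refine ⟨-k, ?_⟩
    push_cast
    rw [neg_sub_neg, Valuation.map_sub_swap]
    exact hk
  mul_mem' := by
    rintro x y ⟨k, hk⟩ ⟨l, hl⟩
    refine ⟨k * l, ?_⟩
    have hx : x ∈ W := by
      rw [← ValuationSubring.valuation_le_one_iff, ← sub_add_cancel x (k : N)]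
      exact W.valuation.map_add_le hk.le ((W.valuation_le_one_iff _).2 (intCast_mem W k))
    push_cast
    rw [show x * y - k * l = x * (y - l) + (x - k) * l by ring]
    refine W.valuation.map_add_lt ?_ ?_
    · rw [map_mul]
      exact mul_lt_one_of_nonneg_of_lt_one_right ((W.valuation_le_one_iff _).2 hx) zero_le hl
    · rw [map_mul]
      exact mul_lt_one_of_nonneg_of_lt_one_left zero_le hk
        ((W.valuation_le_one_iff _).2 (intCast_mem W l))

theorem valuation_lt_one_of_le {A A₀ : ValuationSubring K} (h : A ≤ A₀) {x : K}
    (hx : A₀.valuation x < 1) : A.valuation x < 1 := by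
  rw [← ValuationSubring.mem_nonunits_iff] at hx ⊢
  exact ValuationSubring.nonunits_le_nonunits.2 h hx

/-- Hensel's lemma for a polynomial over `K` with a simple zero close to `1`. -/
theorem exists_root_of_henselian {A : ValuationSubring K} [HenselianLocalRing A]
    {p : Polynomial K} (hp : p.Monic) (hc : ∀ i, p.coeff i ∈ A)
    (h0 : A.valuation (p.eval 1) < 1) (h1 : A.valuation (p.derivative.eval 1 - 1) < 1) :
    ∃ a : K, p.eval a = 0 := by
  have hl : p ∈ Polynomial.lifts (algebraMap A K) := by
    rw [Polynomial.lifts_iff_coeff_lifts]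
    exact fun i => ⟨⟨_, hc i⟩, rfl⟩
  obtain ⟨q, rfl, -, hqm⟩ := Polynomial.lifts_and_natDegree_eq_and_monic hl hp
  have hev : ∀ (r : Polynomial A) (a : A), (r.map (algebraMap A K)).eval (a : K) = (r.eval a : A) :=
    fun r a => Polynomial.eval_map_apply (algebraMap A K) a
  have e0 := hev q 1
  have e1 := hev q.derivative 1
  rw [← Polynomial.derivative_map] at e1
  rw [show ((1 : A) : K) = 1 from rfl] at e0 e1
  rw [e0] at h0
  rw [e1] at h1
  have hu : IsUnit (q.derivative.eval 1) := by
    rw [← residue_ne_zero_iff_isUnit]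
    have : residue A (q.derivative.eval 1) = residue A 1 := (residue_eq_residue_iff A _ _).2 h1
    rw [this, map_one]
    exact one_ne_zero
  obtain ⟨a, ha, -⟩ := HenselianLocalRing.is_henselian q hqm 1
    ((A.valuation_lt_one_iff _).2 h0) hu
  exact ⟨a, by rw [hev, ha]; rfl⟩

/-- If `K` is henselian for a refinement of the restriction of `W`, then `W` is Galois invariant. -/
theorem stabilizer_eq_top [IsGalois K N] {A : ValuationSubring K} [HenselianLocalRing A]
    (W : ValuationSubring N) [CharZero (ResidueField W)] (hA : A ≤ restrict K W) :
    stabilizer K W = ⊤ := by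
  classical
  obtain ⟨β, hβ1, hβτ, hβσ⟩ := exists_stabilizer_invariant_element (K := K) W
  have hint : IsIntegral K β := Algebra.IsIntegral.isIntegral β
  set f := minpoly K β with hf
  have hsplit : (f.map (algebraMap K N)).Splits := Normal.splits inferInstance β
  have hsep : (f.map (algebraMap K N)).Separable := Polynomial.Separable.map (IsGalois.separable K β)
  have hmonic : f.Monic := minpoly.monic hint
  have hmonic' : (f.map (algebraMap K N)).Monic := hmonic.map _
  set R := (f.map (algebraMap K N)).roots.toFinset with hR
  have hnodup : (f.map (algebraMap K N)).roots.Nodup := Polynomial.nodup_roots hsep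
  have hprod : f.map (algebraMap K N) = ∏ r ∈ R, (Polynomial.X - Polynomial.C r) := by
    conv_lhs => rw [hsplit.eq_prod_roots_of_monic hmonic']
    rw [hR, Finset.prod, Multiset.toFinset_val, hnodup.dedup]
  have hroot : ∀ r ∈ R, r ≠ β → W.valuation r < 1 := by
    intro r hr hne
    rw [hR, Multiset.mem_toFinset, Polynomial.mem_roots hmonic'.ne_zero, Polynomial.IsRoot.def,
      Polynomial.eval_map_algebraMap] at hr
    obtain ⟨σ, rfl⟩ := minpoly.exists_algEquiv_of_root' (Algebra.IsAlgebraic.isAlgebraic β) hr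
    exact hβτ σ fun h => hne (hβσ σ h)
  have hβR : β ∈ R := by
    rw [hR, Multiset.mem_toFinset, Polynomial.mem_roots hmonic'.ne_zero, Polynomial.IsRoot.def,
      Polynomial.eval_map_algebraMap, minpoly.aeval]
  have hmemR : ∀ r ∈ R, r ∈ intAddNonunits W := by
    intro r hr
    by_cases h : r = β
    · exact ⟨1, by rw [h]; simpa using hβ1⟩
    · exact ⟨0, by simpa using hroot r hr h⟩
  -- The roots, and therefore the coefficients, lie in the ring `ℤ + 𝔪`, with `𝔪` the maximal ideal
  -- of `W`. As `A ≤ restrict K W`, the trace of `𝔪` on `K` lies in `A`, so the coefficients are in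
  -- the finer ring `A`, where Hensel's Lemma is available.
  have hcoeff : ∀ i, f.coeff i ∈ A := by
    intro i
    have hl : f.map (algebraMap K N) ∈ Polynomial.lifts (intAddNonunits W).subtype := by
      rw [hprod]
      refine prod_mem fun r hr => ?_
      exact ⟨Polynomial.X - Polynomial.C ⟨r, hmemR r hr⟩, by simp⟩
    obtain ⟨⟨y, k, hk⟩, hy⟩ := (Polynomial.lifts_iff_coeff_lifts _).1 hl i
    rw [Polynomial.coeff_map] at hy
    change y = _ at hy
    rw [hy, ← map_intCast (algebraMap K N) k, ← map_sub, ← restrict_valuation_lt_one_iff] at hk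
    have := (A.valuation_le_one_iff _).1 (valuation_lt_one_of_le hA hk).le
    simpa using add_mem this (intCast_mem A k)
  set h := ∏ r ∈ R.erase β, (Polynomial.X - Polynomial.C r) with hh
  have hfac : f.map (algebraMap K N) = (Polynomial.X - Polynomial.C β) * h := by
    rw [hprod, hh, Finset.mul_prod_erase R (fun r => Polynomial.X - Polynomial.C r) hβR]
  have hh1 : W.valuation (h.eval 1 - 1) < 1 := by
    rw [hh, Polynomial.eval_prod]
    refine valuation_prod_sub_one_lt W _ _ fun r hr => ?_
    have := hroot r (Finset.mem_of_mem_erase hr) (Finset.ne_of_mem_erase hr)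
    simpa using this
  have hβ1' : W.valuation (1 - β) < 1 := by rwa [Valuation.map_sub_swap]
  have hhd : h.derivative.eval 1 ∈ W := by
    have hl : h ∈ Polynomial.lifts (algebraMap W N) := by
      rw [hh]
      refine prod_mem fun r hr => ?_
      have := hroot r (Finset.mem_of_mem_erase hr) (Finset.ne_of_mem_erase hr)
      exact ⟨Polynomial.X - Polynomial.C ⟨r, (W.valuation_le_one_iff _).1 this.le⟩, by simp⟩
    obtain ⟨q, hq⟩ := hl
    have hq' : q.map (algebraMap W N) = h := hq
    have := Polynomial.eval_map_apply (p := q.derivative) (algebraMap W N) 1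
    rw [map_one, ← Polynomial.derivative_map, hq'] at this
    rw [this]
    exact (q.derivative.eval 1).2
  have hval : ∀ p : Polynomial K, algebraMap K N (p.eval 1) =
      (p.map (algebraMap K N)).eval 1 := fun p => by
    rw [Polynomial.eval_one_map]
  -- From `f = (X - β) h` with `h(1)` close to `1`, `f(1)` is small and `f'(1) = h(1) + (1 - β)
  -- h'(1)` is close to `1` for `W`. Both bounds pass to `A`, whose maximal ideal contains that of
  -- its coarsening.
  obtain ⟨a, ha⟩ := exists_root_of_henselian (A := A) hmonic hcoeff
    (valuation_lt_one_of_le hA (by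
      rw [restrict_valuation_lt_one_iff, hval, hfac, Polynomial.eval_mul, map_mul]
      refine mul_lt_one_of_nonneg_of_lt_one_left zero_le (by simpa using hβ1') ?_
      rw [← sub_add_cancel (h.eval 1) 1]
      exact W.valuation.map_add_le hh1.le (by rw [map_one])))
    (valuation_lt_one_of_le hA (by
      rw [restrict_valuation_lt_one_iff, map_sub, map_one, hval, ← Polynomial.derivative_map, hfac,
        Polynomial.derivative_mul]
      simp only [Polynomial.derivative_sub, Polynomial.derivative_X, Polynomial.derivative_C,
        sub_zero, one_mul, Polynomial.eval_add, Polynomial.eval_mul, Polynomial.eval_sub,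
        Polynomial.eval_X, Polynomial.eval_C]
      rw [add_sub_right_comm]
      refine W.valuation.map_add_lt hh1 ?_
      rw [map_mul]
      exact mul_lt_one_of_nonneg_of_lt_one_left zero_le hβ1' ((W.valuation_le_one_iff _).2 hhd)))
  have hβK : β = algebraMap K N a := by
    have hdeg : f.degree = 1 := Polynomial.degree_eq_one_of_irreducible_of_root
      (minpoly.irreducible hint) ha
    obtain ⟨b, hb⟩ := minpoly.mem_range_of_degree_eq_one K β hdeg
    rw [← hb] at hf
    rw [minpoly.eq_X_sub_C] at hf
    rw [hf] at ha
    rw [← hb]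
    simp only [Polynomial.eval_sub, Polynomial.eval_X, Polynomial.eval_C] at ha
    rw [sub_eq_zero.1 ha]
  refine eq_top_iff.2 fun τ _ => ?_
  -- Such a `τ` fixes `β ∈ K`, so `β` and `β - 1` would both have value `< 1`, and hence so would
  -- `1`.
  by_contra hτ
  have := hβτ τ hτ
  rw [hβK, AlgEquiv.commutes, ← hβK] at this
  have := W.valuation.map_sub_lt this hβ1
  simp at this

end Invariance

/-! ### Unique extension of valuations to algebraic extensions. -/

section Uniqueness

variable {K : Type u} [Field K]

theorem charZero_residueField_of_restrict {L : Type u} [Field L] [Algebra K L]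
    (B : ValuationSubring L) (h : CharZero (ResidueField (restrict K B))) :
    CharZero (ResidueField B) :=
  charZero_of_injective_ringHom (ResidueField.map (integersMap K B)).injective

theorem minpoly_coeff_mem {N : Type u} [Field N] [Algebra K N] [FiniteDimensional K N]
    [Normal K N] {W : ValuationSubring N} (hW : stabilizer K W = ⊤) {x : N} (hx : x ∈ W) (i : ℕ) :
    (minpoly K x).coeff i ∈ restrict K W := by
  have hsplit : ((minpoly K x).map (algebraMap K N)).Splits := Normal.splits inferInstance x
  have hmonic : ((minpoly K x).map (algebraMap K N)).Monic :=
    (minpoly.monic (Algebra.IsIntegral.isIntegral x)).map _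
  have hl : (minpoly K x).map (algebraMap K N) ∈ Polynomial.lifts (algebraMap W N) := by
    rw [hsplit.eq_prod_roots_of_monic hmonic]
    refine multiset_prod_mem _ fun p hp => ?_
    obtain ⟨r, hr, rfl⟩ := Multiset.mem_map.1 hp
    rw [Polynomial.mem_roots hmonic.ne_zero, Polynomial.IsRoot.def,
      Polynomial.eval_map_algebraMap] at hr
    obtain ⟨σ, rfl⟩ := minpoly.exists_algEquiv_of_root' (Algebra.IsAlgebraic.isAlgebraic x) hr
    have hσ : σ ∈ stabilizer K W := hW ▸ Subgroup.mem_top σ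
    exact ⟨Polynomial.X - Polynomial.C ⟨σ x, hσ x hx⟩, by simp⟩
  obtain ⟨y, hy⟩ := (Polynomial.lifts_iff_coeff_lifts _).1 hl i
  rw [Polynomial.coeff_map] at hy
  rw [mem_restrict, ← hy]
  exact y.2

/-- The valuation with valuation ring `A₀` has at most one extension to each algebraic extension. -/
def HasUniqueExtensions (A₀ : ValuationSubring K) : Prop :=
  ∀ (L : Type u) [Field L] [Algebra K L] [Algebra.IsAlgebraic K L] (B B' : ValuationSubring L),
    restrict K B = A₀ → restrict K B' = A₀ → B = B'

/-- Extend `B` to an algebraic closure and restrict to a finite Galois `N | K` containing `x`. This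
restriction is Galois invariant, so the minimal polynomial of `x` has coefficients in `A₀`; hence
`x` is integral over `A₀` and lies in every extension of it. -/
theorem le_of_henselian {A A₀ : ValuationSubring K} [HenselianLocalRing A] (hA : A ≤ A₀)
    (h0 : CharZero (ResidueField A₀)) (L : Type u) [Field L] [Algebra K L]
    [Algebra.IsAlgebraic K L] (B B' : ValuationSubring L) (hB : restrict K B = A₀)
    (hB' : restrict K B' = A₀) : B ≤ B' := by
  intro x hx
  have hK : CharZero K := charZero_of_charZero_residueField A₀
  let Ω := AlgebraicClosure L
  obtain ⟨V, hV⟩ := exists_restrict_eq Ω B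
  have halg : Algebra.IsAlgebraic K Ω := Algebra.IsAlgebraic.trans K L Ω
  have hclos : IsAlgClosure K Ω := ⟨inferInstance, halg⟩
  have hnorm : Normal K Ω := IsAlgClosure.normal K Ω
  let y : Ω := algebraMap L Ω x
  have hy : IsIntegral K y := Algebra.IsIntegral.isIntegral y
  have hfin : FiniteDimensional K (IntermediateField.adjoin K {y}) :=
    IntermediateField.adjoin.finiteDimensional hy
  let N := IntermediateField.normalClosure K (IntermediateField.adjoin K {y}) Ω
  have hle : IntermediateField.adjoin K {y} ≤ N := by
    have := AlgHom.fieldRange_le_normalClosure (IntermediateField.adjoin K {y}).val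
    rwa [IntermediateField.fieldRange_val] at this
  have hyN : y ∈ N := hle (IntermediateField.mem_adjoin_simple_self K y)
  have hgal : IsGalois K N := ⟨⟩
  let W : ValuationSubring N := restrict N V
  have hW : restrict K W = A₀ := by
    rw [restrict_restrict, ← restrict_restrict (L := L), hV, hB]
  have hres : CharZero (ResidueField W) := charZero_residueField_of_restrict (K := K) W (hW ▸ h0)
  have hst : stabilizer K W = ⊤ := stabilizer_eq_top W (hW ▸ hA)
  have hyW : (⟨y, hyN⟩ : N) ∈ W := by
    change algebraMap L Ω x ∈ V
    rw [← mem_restrict, hV]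
    exact hx
  have hmin : minpoly K (⟨y, hyN⟩ : N) = minpoly K x := by
    rw [← minpoly.algebraMap_eq (algebraMap L Ω).injective x,
      ← minpoly.algebraMap_eq (algebraMap N Ω).injective]
    rfl
  refine mem_of_monic_of_eval_eq_zero B' (p := (minpoly K x).map (algebraMap K L))
    ((minpoly.monic (Algebra.IsIntegral.isIntegral x)).map _) (fun i => ?_) ?_
  · rw [Polynomial.coeff_map, ← mem_restrict, hB', ← hW, ← hmin]
    exact minpoly_coeff_mem hst hyW i
  · rw [Polynomial.eval_map_algebraMap, minpoly.aeval]

theorem hasUniqueExtensions_of_henselian {A A₀ : ValuationSubring K} [HenselianLocalRing A]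
    (hA : A ≤ A₀) (h0 : CharZero (ResidueField A₀)) : HasUniqueExtensions A₀ := by
  intro L _ _ _ B B' hB hB'
  exact le_antisymm (le_of_henselian hA h0 L B B' hB hB') (le_of_henselian hA h0 L B' B hB' hB)

theorem eq_top_of_restrict_eq_top {L : Type u} [Field L] [Algebra K L] [Algebra.IsAlgebraic K L]
    {B : ValuationSubring L} (hB : restrict K B = ⊤) : B = ⊤ := by
  refine top_unique fun x _ => mem_of_monic_of_eval_eq_zero B
    (p := (minpoly K x).map (algebraMap K L))
    ((minpoly.monic (Algebra.IsIntegral.isIntegral x)).map _) (fun i => ?_) ?_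
  · rw [Polynomial.coeff_map, ← mem_restrict, hB]
    trivial
  · rw [Polynomial.eval_map_algebraMap, minpoly.aeval]

theorem hasUniqueExtensions_top : HasUniqueExtensions (⊤ : ValuationSubring K) := by
  intro L _ _ _ B B' hB hB'
  rw [eq_top_of_restrict_eq_top hB, eq_top_of_restrict_eq_top hB']

theorem HasUniqueExtensions.of_restrict {L : Type u} [Field L] [Algebra K L]
    [Algebra.IsAlgebraic K L] {B : ValuationSubring L} (h : HasUniqueExtensions (restrict K B)) :
    HasUniqueExtensions B := by
  intro M _ _ _ C C' hC hC'
  let : Algebra K M := ((algebraMap L M).comp (algebraMap K L)).toAlgebra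
  have : IsScalarTower K L M := IsScalarTower.of_algebraMap_eq' rfl
  have : Algebra.IsAlgebraic K M := Algebra.IsAlgebraic.trans K L M
  exact h M C C' (by rw [← restrict_restrict (L := L), hC])
    (by rw [← restrict_restrict (L := L), hC'])

theorem HasUniqueExtensions.stabilizer_eq_top {N : Type u} [Field N] [Algebra K N]
    [FiniteDimensional K N] {W : ValuationSubring N} (h : HasUniqueExtensions (restrict K W)) :
    stabilizer K W = ⊤ := by
  refine eq_top_iff.2 fun σ _ => ?_
  have h1 : W.comap (σ : N →+* N) = W := by
    refine h N _ _ ?_ rfl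
    ext x
    change σ (algebraMap K N x) ∈ W ↔ algebraMap K N x ∈ W
    rw [AlgEquiv.commutes]
  intro x hx
  rw [← h1] at hx
  exact hx

end Uniqueness

/-! ### Counting automorphisms through residue action and inertia characters. -/

section Galois

variable {K N : Type u} [Field K] [Field N] [Algebra K N] [FiniteDimensional K N]
  {W : ValuationSubring N}

theorem valuation_apply_le_iff (hW : stabilizer K W = ⊤) (σ : N ≃ₐ[K] N) (x y : N) :
    W.valuation (σ x) ≤ W.valuation (σ y) ↔ W.valuation x ≤ W.valuation y := by
  by_cases hy : y = 0
  · simp [hy]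
  have h1 : W.valuation (σ y) ≠ 0 := by simpa using hy
  have h2 : W.valuation y ≠ 0 := by simpa using hy
  rw [← div_le_one₀ (zero_lt_iff.2 h1), ← div_le_one₀ (zero_lt_iff.2 h2), ← map_div₀, ← map_div₀,
    ← map_div₀, ValuationSubring.valuation_le_one_iff, ValuationSubring.valuation_le_one_iff]
  exact apply_mem_iff (hW ▸ Subgroup.mem_top σ) _

/-- Automorphisms preserve the order of values. Since `σ` has finite order, a strict inequality
between the values of `x` and `σ x` would return to `x` on iteration. -/
theorem valuation_apply (hW : stabilizer K W = ⊤) (σ : N ≃ₐ[K] N) (x : N) :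
    W.valuation (σ x) = W.valuation x := by
  have key : ∀ (σ : N ≃ₐ[K] N) (x : N), W.valuation (σ x) ≤ W.valuation x →
      W.valuation x ≤ W.valuation (σ x) := by
    intro σ x h
    have hpow : ∀ n : ℕ, W.valuation ((σ ^ n) (σ x)) ≤ W.valuation (σ x) := by
      intro n
      induction n with
      | zero => exact le_rfl
      | succ n ih =>
        rw [pow_succ', AlgEquiv.mul_apply, valuation_apply_le_iff hW]
        exact ih.trans h
    have := hpow (orderOf σ - 1)
    rwa [← AlgEquiv.mul_apply, ← pow_succ, Nat.sub_add_cancel (orderOf_pos σ), pow_orderOf_eq_one,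
      AlgEquiv.one_apply] at this
  rcases le_total (W.valuation (σ x)) (W.valuation x) with h | h
  · exact le_antisymm h (key σ x h)
  · refine le_antisymm ?_ h
    have := key σ⁻¹ (σ x)
    rw [← AlgEquiv.mul_apply, inv_mul_cancel, AlgEquiv.one_apply] at this
    exact this h

/-- In residue characteristic zero there is no wild ramification. -/
theorem eq_one_of_valuation_sub_lt [CharZero (ResidueField W)] (hW : stabilizer K W = ⊤)
    (σ : N ≃ₐ[K] N) (hσ : ∀ x ≠ 0, W.valuation (σ x - x) < W.valuation x) : σ = 1 := by
  have hpow : ∀ (n : ℕ) (x : N), x ≠ 0 → W.valuation ((σ ^ n) x - x) < W.valuation x := by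
    intro n x hx
    induction n with
    | zero => simpa [zero_lt_iff] using hx
    | succ n ih =>
      rw [pow_succ, AlgEquiv.mul_apply,
        show (σ ^ n) (σ x) - x = (σ ^ n) (σ x - x) + ((σ ^ n) x - x) by rw [map_sub]; ring]
      refine W.valuation.map_add_lt ?_ ih
      rw [valuation_apply hW]
      exact hσ x hx
  ext x
  rw [AlgEquiv.one_apply, ← sub_eq_zero]
  by_contra hne
  set y := σ x - x with hy
  -- The trace of `y = σ x - x` over the powers of `σ` telescopes to zero. All terms agree with `y`
  -- up to smaller elements, so it also differs from `orderOf σ • y` by less than the value of `y`,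
  -- and `orderOf σ` has value `1`.
  have h0 : ∑ i ∈ Finset.range (orderOf σ), (σ ^ i) y = 0 := by
    have : ∀ i, (σ ^ i) y = (σ ^ (i + 1)) x - (σ ^ i) x := fun i => by
      rw [hy, map_sub, pow_succ, AlgEquiv.mul_apply]
    simp only [this]
    rw [Finset.sum_range_sub (fun i => (σ ^ i) x), pow_orderOf_eq_one, pow_zero, sub_self]
  have h1 : W.valuation (∑ i ∈ Finset.range (orderOf σ), ((σ ^ i) y - y)) < W.valuation y :=
    W.valuation.map_sum_lt (by simpa using hne) fun i _ => hpow i y hne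
  rw [Finset.sum_sub_distrib, h0, Finset.sum_const, Finset.card_range, zero_sub,
    Valuation.map_neg, nsmul_eq_mul, map_mul, valuation_natCast W (orderOf_pos σ).ne',
    one_mul] at h1
  exact lt_irrefl _ h1

/-- The action of an automorphism on the valuation ring. -/
def integersEnd (hW : stabilizer K W = ⊤) (σ : N ≃ₐ[K] N) : W →+* W :=
  (σ : N →+* N).restrict W W fun x hx => (hW ▸ Subgroup.mem_top σ : σ ∈ stabilizer K W) x hx

theorem coe_integersEnd (hW : stabilizer K W = ⊤) (σ : N ≃ₐ[K] N) (x : W) :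
    (integersEnd hW σ x : N) = σ x := rfl

instance isLocalHom_integersEnd (hW : stabilizer K W = ⊤) (σ : N ≃ₐ[K] N) :
    IsLocalHom (integersEnd hW σ) where
  map_nonunit a ha := by
    rw [ValuationSubring.valuation_eq_one_iff] at ha ⊢
    rwa [coe_integersEnd, valuation_apply hW] at ha

/-- The action of an automorphism on the residue field. -/
def residueEnd (hW : stabilizer K W = ⊤) (σ : N ≃ₐ[K] N) :
    ResidueField W →ₐ[residueImage K W] ResidueField W where
  __ := ResidueField.map (integersEnd hW σ)
  commutes' := by
    rintro ⟨y, hy⟩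
    obtain ⟨a, h, rfl⟩ := mem_residueImage.1 hy
    refine congrArg (residue W) (Subtype.ext ?_)
    exact σ.commutes a

theorem residueEnd_residue (hW : stabilizer K W = ⊤) (σ : N ≃ₐ[K] N) (x : W) :
    residueEnd hW σ (residue W x) = residue W (integersEnd hW σ x) := rfl

/-- An automorphism acting trivially on the residue field. -/
def IsInertial (W : ValuationSubring N) (σ : N ≃ₐ[K] N) : Prop :=
  ∀ x ∈ W, W.valuation (σ x - x) < 1

theorem isInertial_of_residueEnd_eq (hW : stabilizer K W = ⊤) {σ τ : N ≃ₐ[K] N}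
    (h : residueEnd hW σ = residueEnd hW τ) : IsInertial W (τ⁻¹ * σ) := by
  intro x hx
  have := congrArg (fun f => f (residue W ⟨x, hx⟩)) h
  simp only [residueEnd_residue, residue_eq_residue_iff, coe_integersEnd] at this
  rw [← valuation_apply hW τ, map_sub, ← AlgEquiv.mul_apply, mul_inv_cancel_left]
  exact this

theorem apply_div_mem (hW : stabilizer K W = ⊤) (σ : N ≃ₐ[K] N) (x : N) : σ x / x ∈ W := by
  rw [← ValuationSubring.valuation_le_one_iff, map_div₀, valuation_apply hW]
  exact div_self_le_one _

/-- The character `x ↦ σ x / x` of the value group attached to an inertial automorphism. -/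
def inertialCharacter (hW : stabilizer K W = ⊤) (σ : N ≃ₐ[K] N) (hσ : IsInertial W σ) :
    (Nˣ ⧸ valueSubgroup K W) →* ResidueField W :=
  QuotientGroup.lift (valueSubgroup K W)
    { toFun := fun x => residue W ⟨σ x / x, apply_div_mem hW σ x⟩
      map_one' := by
        rw [← map_one (residue W)]
        exact congrArg _ (Subtype.ext (by simp))
      map_mul' := fun x y => by
        rw [← map_mul]
        refine congrArg _ (Subtype.ext ?_)
        change σ ((x * y : Nˣ) : N) / ((x * y : Nˣ) : N) = σ x / x * (σ y / y)
        rw [Units.val_mul, map_mul, mul_div_mul_comm] } (by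
    intro x hx
    obtain ⟨a, ha⟩ := mem_valueSubgroup.1 hx
    have ha0 : algebraMap K N a ≠ 0 := by simp
    have hu : W.valuation (x / algebraMap K N a) = 1 := by
      rw [map_div₀, ha]
      exact div_self (by simp)
    have h1 := hσ _ ((W.valuation_le_one_iff _).1 hu.le)
    change residue W ⟨σ x / x, _⟩ = 1
    rw [← map_one (residue W), residue_eq_residue_iff]
    change W.valuation (σ x / x - 1) < 1
    rw [map_div₀, AlgEquiv.commutes, ← sub_div, map_div₀, ← ha, ← map_div₀, sub_div,
      div_self x.ne_zero] at h1
    exact h1)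

theorem inertialCharacter_mk (hW : stabilizer K W = ⊤) (σ : N ≃ₐ[K] N) (hσ : IsInertial W σ)
    (x : Nˣ) : inertialCharacter hW σ hσ (x : Nˣ ⧸ valueSubgroup K W) =
      residue W ⟨σ x / x, apply_div_mem hW σ x⟩ := rfl

theorem eq_of_inertialCharacter_eq [CharZero (ResidueField W)] (hW : stabilizer K W = ⊤)
    {σ τ : N ≃ₐ[K] N} {hσ : IsInertial W σ} {hτ : IsInertial W τ}
    (h : inertialCharacter hW σ hσ = inertialCharacter hW τ hτ) : σ = τ := by
  have : τ⁻¹ * σ = 1 := by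
    refine eq_one_of_valuation_sub_lt hW _ fun x hx => ?_
    have h1 := congrArg (fun f => f ((Units.mk0 x hx : Nˣ) : Nˣ ⧸ valueSubgroup K W)) h
    simp only [inertialCharacter_mk, residue_eq_residue_iff, Units.val_mk0] at h1
    rw [← valuation_apply hW τ, map_sub, ← AlgEquiv.mul_apply, mul_inv_cancel_left]
    rwa [← sub_div, map_div₀, div_lt_one₀ (zero_lt_iff.2 (by simpa using hx))] at h1
  exact (inv_mul_eq_one.1 this).symm

/-- Dedekind independence: the characters are linearly independent in the space of functions `Q →
k`, of dimension `|Q|`. -/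
theorem card_monoidHom_le (Q k : Type u) [CommGroup Q] [Finite Q] [Field k] :
    Finite (Q →* k) ∧ Nat.card (Q →* k) ≤ Nat.card Q := by
  have := Fintype.ofFinite Q
  have hli := linearIndependent_monoidHom Q k
  have hfin : Finite (Q →* k) := hli.finite
  have := Fintype.ofFinite (Q →* k)
  refine ⟨hfin, ?_⟩
  rw [Nat.card_eq_fintype_card, Nat.card_eq_fintype_card,
    ← Module.finrank_fintype_fun_eq_card k (η := Q)]
  exact hli.fintype_card_le_finrank

theorem finrank_le_of_isGalois [IsGalois K N] [CharZero (ResidueField W)]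
    (hW : stabilizer K W = ⊤) :
    Module.finrank K N ≤ ramificationIndex K W * inertiaDegree K W := by
  classical
  obtain ⟨he, hf, -⟩ := fundamental_inequality (K := K) W
  rw [inertiaDegree_eq_finrank] at hf ⊢
  rw [ramificationIndex_eq_index] at he ⊢
  have hk : FiniteDimensional (residueImage K W) (ResidueField W) :=
    Module.finite_of_finrank_pos (Nat.pos_of_ne_zero hf)
  have hQ : Finite (Nˣ ⧸ valueSubgroup K W) := Nat.finite_of_card_ne_zero he
  obtain ⟨hfin, hcard⟩ := card_monoidHom_le (Nˣ ⧸ valueSubgroup K W) (ResidueField W)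
  -- `g` picks one automorphism for each residue action that occurs. Then `σ` is determined by its
  -- residue action and the character of the inertial automorphism by which it differs from the
  -- chosen one.
  let g : (ResidueField W →ₐ[residueImage K W] ResidueField W) → (N ≃ₐ[K] N) :=
    Function.invFun (residueEnd hW)
  have hg : ∀ σ, residueEnd hW (g (residueEnd hW σ)) = residueEnd hW σ := fun σ =>
    Function.invFun_eq ⟨σ, rfl⟩
  let F : (N ≃ₐ[K] N) → ((Nˣ ⧸ valueSubgroup K W) →* ResidueField W) ×
      (ResidueField W →ₐ[residueImage K W] ResidueField W) := fun σ =>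
    (inertialCharacter hW ((g (residueEnd hW σ))⁻¹ * σ)
      (isInertial_of_residueEnd_eq hW (hg σ).symm), residueEnd hW σ)
  have hF : Function.Injective F := by
    intro σ τ h
    have h2 : residueEnd hW σ = residueEnd hW τ := congrArg Prod.snd h
    have h1 := eq_of_inertialCharacter_eq hW
      (hσ := isInertial_of_residueEnd_eq hW (hg σ).symm)
      (hτ := isInertial_of_residueEnd_eq hW (hg τ).symm) (congrArg Prod.fst h)
    rw [h2] at h1
    exact mul_left_cancel h1
  rw [← IsGalois.card_aut_eq_finrank]
  refine (Nat.card_le_card_of_injective F hF).trans ?_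
  rw [Nat.card_prod]
  exact Nat.mul_le_mul hcard (by
    rw [Nat.card_eq_fintype_card]
    exact AlgHom.card_le)

end Galois

/-! ### The coarsening `v₀` extends uniquely and without defect. -/

section Defectless

variable {K L : Type u} [Field K] [Field L] [Algebra K L]

/-- Apply the Galois bound to the normal closure `N`. There `e f` factors through `L`, and the part
for `N | L` is at most `[N : L]`, which cancels. -/
theorem finrank_eq_of_charZero [FiniteDimensional K L] (B : ValuationSubring L)
    (h : HasUniqueExtensions (restrict K B)) (h0 : CharZero (ResidueField (restrict K B))) :
    Module.finrank K L = ramificationIndex K B * inertiaDegree K B := by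
  have hK : CharZero K := charZero_of_charZero_residueField (restrict K B)
  refine le_antisymm ?_ (fundamental_inequality B).2.2
  let Ω := AlgebraicClosure L
  have halg : Algebra.IsAlgebraic K Ω := Algebra.IsAlgebraic.trans K L Ω
  have hclos : IsAlgClosure K Ω := ⟨inferInstance, halg⟩
  have hnorm : Normal K Ω := IsAlgClosure.normal K Ω
  let N := IntermediateField.normalClosure K L Ω
  have hgal : IsGalois K N := ⟨⟩
  have hfin : FiniteDimensional L N := FiniteDimensional.right K L N
  obtain ⟨W, rfl⟩ := exists_restrict_eq N B
  rw [restrict_restrict] at h h0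
  have hres : CharZero (ResidueField W) := charZero_residueField_of_restrict (K := K) W h0
  have h1 := finrank_le_of_isGalois h.stabilizer_eq_top
  have h2 := (fundamental_inequality (K := L) W).2.2
  rw [ramificationIndex_tower (L := L), inertiaDegree_tower (L := L), mul_mul_mul_comm,
    ← Module.finrank_mul_finrank K L N] at h1
  exact Nat.le_of_mul_le_mul_right (h1.trans (Nat.mul_le_mul_left _ h2)) Module.finrank_pos

theorem finrank_eq_of_top [FiniteDimensional K L] (B : ValuationSubring L)
    (h : restrict K B = ⊤) :
    Module.finrank K L = ramificationIndex K B * inertiaDegree K B := by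
  have hB : ∀ x : L, x ∈ B := fun x => by
    rw [eq_top_of_restrict_eq_top h]
    trivial
  have he : ramificationIndex K B = 1 := by
    rw [ramificationIndex_eq_index, Subgroup.index_eq_one]
    refine eq_top_iff.2 fun x _ => mem_valueSubgroup.2 ⟨1, ?_⟩
    have hu : IsUnit (⟨x, hB x⟩ : B) :=
      IsUnit.of_mul_eq_one ⟨_, hB (x : L)⁻¹⟩ (Subtype.ext (mul_inv_cancel₀ x.ne_zero))
    have := (B.valuation_eq_one_iff _).1 hu
    simpa using this
  let j : L →+* ResidueField B := (residue B).comp ((RingHom.id L).codRestrict B hB)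
  have hj : Function.Bijective j := by
    refine ⟨j.injective, fun y => ?_⟩
    obtain ⟨x, rfl⟩ := residue_surjective y
    exact ⟨x, rfl⟩
  rw [he, one_mul, inertiaDegree_eq_finrank, finrank_fieldRange]
  refine finrank_eq_of_comap_eq (RingEquiv.ofBijective j hj) _ _ ?_
  ext x
  rw [Subfield.mem_comap, mem_residueImage, RingHom.mem_fieldRange]
  constructor
  · rintro ⟨a, ha, e⟩
    exact ⟨a, hj.1 e⟩
  · rintro ⟨a, rfl⟩
    exact ⟨a, hB _, rfl⟩

/-- Extensions to algebraic extensions are unique, and the valuation is trivial or of residue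
characteristic zero. -/
structure IsUniqueDefectless (A₀ : ValuationSubring K) : Prop where
  hasUniqueExtensions : HasUniqueExtensions A₀
  eq_top_or_charZero : A₀ = ⊤ ∨ CharZero (ResidueField A₀)

theorem IsUniqueDefectless.finrank_eq [FiniteDimensional K L] {B : ValuationSubring L}
    (h : IsUniqueDefectless (restrict K B)) :
    Module.finrank K L = ramificationIndex K B * inertiaDegree K B :=
  h.2.elim (finrank_eq_of_top B) (finrank_eq_of_charZero B h.1)

theorem IsUniqueDefectless.of_restrict [Algebra.IsAlgebraic K L] {B : ValuationSubring L}
    (h : IsUniqueDefectless (restrict K B)) : IsUniqueDefectless B :=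
  ⟨h.1.of_restrict, h.2.imp eq_top_of_restrict_eq_top (charZero_residueField_of_restrict B)⟩

/-- Henselianity enters the main theorem only through this statement. -/
theorem isUniqueDefectless_coreCoarsening (A : ValuationSubring K) [HenselianLocalRing A] :
    IsUniqueDefectless (coreCoarsening A) := by
  by_cases hK : CharZero K
  · have h := (coreCoarsening_isLeast A).1.2
    exact ⟨hasUniqueExtensions_of_henselian (le_coreCoarsening A) h, Or.inr h⟩
  · rw [coreCoarsening_eq_top A hK]
    exact ⟨hasUniqueExtensions_top, Or.inl rfl⟩

end Defectless

/-! ### Composite valuations and their invariants. -/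

section Composition

variable {K : Type u} [Field K]

/-- The valuation ring induced by `A` on the residue field of a coarsening `A₀`. -/
def residueValuation {A A₀ : ValuationSubring K} (h : A ≤ A₀) :
    ValuationSubring (ResidueField A₀) :=
  ValuationSubring.ofSubring ((residue A₀).comp (A.inclusion A₀ h)).range <| by
    intro y
    obtain ⟨x, rfl⟩ := residue_surjective y
    by_cases hx0 : residue A₀ x = 0
    · exact Or.inl (hx0 ▸ zero_mem _)
    rcases A.mem_or_inv_mem (x : K) with hx | hx
    · exact Or.inl ⟨⟨x, hx⟩, rfl⟩
    · refine Or.inr ⟨⟨(x : K)⁻¹, hx⟩, eq_inv_of_mul_eq_one_left ?_⟩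
      have h0 : (x : K) ≠ 0 := fun h => hx0 (by rw [show x = 0 from Subtype.ext h, map_zero])
      rw [RingHom.comp_apply, ← map_mul, ← map_one (residue A₀)]
      exact congrArg _ (Subtype.ext (inv_mul_cancel₀ h0))

/-- From here on the coarsening `A₀` is arbitrary, so the results also apply over an extension `L`
without identifying the core coarsening there. -/
theorem coreValuation_eq (A : ValuationSubring K) :
    coreValuation A = residueValuation (le_coreCoarsening A) := rfl

theorem mem_residueValuation {A A₀ : ValuationSubring K} {h : A ≤ A₀} {y : ResidueField A₀} :
    y ∈ residueValuation h ↔ ∃ (a : K) (ha : a ∈ A), residue A₀ ⟨a, h ha⟩ = y :=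
  ⟨fun ⟨a, e⟩ => ⟨a, a.2, e⟩, fun ⟨a, ha, e⟩ => ⟨⟨a, ha⟩, e⟩⟩

/-- The composition of the valuation of `A₀` with a valuation of its residue field. -/
def composite {A₀ : ValuationSubring K} (C : ValuationSubring (ResidueField A₀)) :
    ValuationSubring K :=
  ValuationSubring.ofSubring ((C.toSubring.comap (residue A₀)).map A₀.subtype) <| by
    intro x
    by_cases hx0 : x = 0
    · exact Or.inl (hx0 ▸ zero_mem _)
    wlog hx : x ∈ A₀ generalizing x
    · have := this x⁻¹ (inv_ne_zero hx0) ((A₀.mem_or_inv_mem x).resolve_left hx)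
      rwa [inv_inv, or_comm] at this
    rcases C.mem_or_inv_mem (residue A₀ ⟨x, hx⟩) with h | h
    · exact Or.inl ⟨⟨x, hx⟩, h, rfl⟩
    by_cases hxi : x⁻¹ ∈ A₀
    · refine Or.inr ⟨⟨x⁻¹, hxi⟩, ?_, rfl⟩
      rwa [← eq_inv_of_mul_eq_one_right (b := residue A₀ ⟨x⁻¹, hxi⟩)] at h
      rw [← map_mul, ← map_one (residue A₀)]
      exact congrArg _ (Subtype.ext (mul_inv_cancel₀ hx0))
    · refine Or.inl ⟨⟨x, hx⟩, ?_, rfl⟩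
      have : residue A₀ ⟨x, hx⟩ = 0 := by
        rw [residue_eq_zero_iff_valuation, ← ValuationSubring.mem_nonunits_iff,
          ValuationSubring.mem_nonunits_iff_or]
        exact Or.inr hxi
      change residue A₀ ⟨x, hx⟩ ∈ C
      rw [this]
      exact C.zero_mem

theorem mem_composite {A₀ : ValuationSubring K} {C : ValuationSubring (ResidueField A₀)} {x : K} :
    x ∈ composite C ↔ ∃ h : x ∈ A₀, residue A₀ ⟨x, h⟩ ∈ C := by
  constructor
  · rintro ⟨y, hy, rfl⟩
    exact ⟨y.2, hy⟩
  · rintro ⟨h, hC⟩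
    exact ⟨⟨x, h⟩, hC, rfl⟩

theorem composite_le {A₀ : ValuationSubring K} (C : ValuationSubring (ResidueField A₀)) :
    composite C ≤ A₀ := fun _ hx => (mem_composite.1 hx).1

theorem residueValuation_composite {A₀ : ValuationSubring K}
    (C : ValuationSubring (ResidueField A₀)) : residueValuation (composite_le C) = C := by
  ext y
  rw [mem_residueValuation]
  constructor
  · rintro ⟨a, ha, rfl⟩
    exact (mem_composite.1 ha).2
  · intro hy
    obtain ⟨x, rfl⟩ := residue_surjective y
    exact ⟨x, mem_composite.2 ⟨x.2, hy⟩, rfl⟩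

theorem composite_residueValuation {A A₀ : ValuationSubring K} (h : A ≤ A₀) :
    composite (residueValuation h) = A := by
  ext x
  rw [mem_composite]
  constructor
  · rintro ⟨hx, hr⟩
    obtain ⟨a, ha, e⟩ := mem_residueValuation.1 hr
    rw [residue_eq_residue_iff] at e
    have h1 : A.valuation (a - x) < 1 := valuation_lt_one_of_le h e
    have h2 := (A.valuation_le_one_iff _).1 h1.le
    simpa using sub_mem ha h2
  · intro hx
    exact ⟨h hx, mem_residueValuation.2 ⟨x, hx, rfl⟩⟩

theorem composite_injective {A₀ : ValuationSubring K} :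
    Function.Injective (composite : ValuationSubring (ResidueField A₀) → ValuationSubring K) := by
  intro C C' h
  ext y
  obtain ⟨x, rfl⟩ := residue_surjective y
  have h1 : ∀ D : ValuationSubring (ResidueField A₀), residue A₀ x ∈ D ↔ (x : K) ∈ composite D :=
    fun D => by
      rw [mem_composite]
      exact ⟨fun hD => ⟨x.2, hD⟩, fun ⟨_, hD⟩ => hD⟩
  rw [h1, h1, h]

theorem composite_valuation_eq_iff {A₀ : ValuationSubring K}
    (C : ValuationSubring (ResidueField A₀)) (x y : A₀ˣ) :
    (composite C).valuation ((x : A₀) : K) = (composite C).valuation ((y : A₀) : K) ↔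
      C.valuation (residue A₀ x) = C.valuation (residue A₀ y) := by
  have key : ∀ x y : A₀ˣ,
      (composite C).valuation ((x : A₀) : K) ≤ (composite C).valuation ((y : A₀) : K) ↔
        C.valuation (residue A₀ x) ≤ C.valuation (residue A₀ y) := by
    intro x y
    have hy : ((y : A₀) : K) ≠ 0 := by simp
    have hy' : residue A₀ y ≠ 0 := (residue_ne_zero_iff_isUnit _).2 y.isUnit
    have h1 : ((x : A₀) : K) / ((y : A₀) : K) = ((x * y⁻¹ : A₀ˣ) : A₀) := by
      rw [div_eq_iff hy, ← MulMemClass.coe_mul, ← Units.val_mul, inv_mul_cancel_right]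
    have h2 : residue A₀ x / residue A₀ y = residue A₀ ((x * y⁻¹ : A₀ˣ) : A₀) := by
      rw [div_eq_iff hy', ← map_mul, ← Units.val_mul, inv_mul_cancel_right]
    rw [← div_le_one₀ (zero_lt_iff.2 (by simp)), ← map_div₀,
      ← div_le_one₀ (a := C.valuation _) (zero_lt_iff.2 (by simp)), ← map_div₀,
      ValuationSubring.valuation_le_one_iff, ValuationSubring.valuation_le_one_iff, h1, h2,
      mem_composite]
    exact ⟨fun ⟨_, h⟩ => h, fun h => ⟨Subtype.prop _, h⟩⟩
  rw [le_antisymm_iff, le_antisymm_iff, key, key]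

theorem valuation_eq_of_le {A A₀ : ValuationSubring K} (h : A ≤ A₀) {x y : K}
    (e : A.valuation x = A.valuation y) : A₀.valuation x = A₀.valuation y := by
  rw [← A.mapOfLE_valuation_apply A₀ h, e, A.mapOfLE_valuation_apply]

/-- The reduction map of the valuation rings of a composite valuation. -/
def compositeMap {A₀ : ValuationSubring K} (C : ValuationSubring (ResidueField A₀)) :
    composite C →+* C :=
  ((residue A₀).comp ((composite C).inclusion A₀ (composite_le C))).codRestrict C
    fun x => (mem_composite.1 x.2).2

theorem coe_compositeMap {A₀ : ValuationSubring K} (C : ValuationSubring (ResidueField A₀))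
    (x : composite C) :
    (compositeMap C x : ResidueField A₀) = residue A₀ ⟨x, composite_le C x.2⟩ := rfl

theorem compositeMap_surjective {A₀ : ValuationSubring K}
    (C : ValuationSubring (ResidueField A₀)) : Function.Surjective (compositeMap C) := by
  rintro ⟨y, hy⟩
  obtain ⟨x, rfl⟩ := residue_surjective y
  exact ⟨⟨x, mem_composite.2 ⟨x.2, hy⟩⟩, rfl⟩

instance isLocalHom_compositeMap {A₀ : ValuationSubring K}
    (C : ValuationSubring (ResidueField A₀)) : IsLocalHom (compositeMap C) where
  map_nonunit x hx := by
    have hx1 : residue A₀ ⟨x, composite_le C x.2⟩ ≠ 0 := fun h => by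
      rw [ValuationSubring.valuation_eq_one_iff, coe_compositeMap, h, map_zero] at hx
      exact zero_ne_one hx
    obtain ⟨u, hu⟩ := (residue_ne_zero_iff_isUnit _).1 hx1
    have h1 := composite_valuation_eq_iff C u 1
    rw [hu, Units.val_one, map_one, map_one] at h1
    rw [ValuationSubring.valuation_eq_one_iff] at hx ⊢
    have h2 := h1.2 hx
    simpa using h2

/-- The residue fields of `v₀ ∘ v₁` and `v₁` agree. -/
def residueFieldEquiv {A₀ : ValuationSubring K} (C : ValuationSubring (ResidueField A₀)) :
    ResidueField (composite C) ≃+* ResidueField C :=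
  RingEquiv.ofBijective (ResidueField.map (compositeMap C)) ⟨RingHom.injective _, fun y => by
    obtain ⟨z, rfl⟩ := residue_surjective y
    obtain ⟨x, rfl⟩ := compositeMap_surjective C z
    exact ⟨residue _ x, rfl⟩⟩

variable {L : Type u} [Field L] [Algebra K L]

/-- The residue field extension of an extension of valuations. -/
abbrev residueAlgebra (K : Type u) {L : Type u} [Field K] [Field L] [Algebra K L]
    (B : ValuationSubring L) : Algebra (ResidueField (restrict K B)) (ResidueField B) :=
  (ResidueField.map (integersMap K B)).toAlgebra

section

attribute [local instance] residueAlgebra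

theorem restrict_composite {B₀ : ValuationSubring L} (C : ValuationSubring (ResidueField B₀)) :
    restrict K (composite C) = composite (restrict (ResidueField (restrict K B₀)) C) := by
  ext x
  rw [mem_restrict, mem_composite, mem_composite]
  rfl

theorem inertiaDegree_composite {B₀ : ValuationSubring L}
    (C : ValuationSubring (ResidueField B₀)) :
    inertiaDegree K (composite C) = inertiaDegree (ResidueField (restrict K B₀)) C := by
  rw [inertiaDegree_eq_finrank, inertiaDegree_eq_finrank]
  refine finrank_eq_of_comap_eq (residueFieldEquiv C) _ _ ?_
  ext y
  rw [Subfield.mem_comap, mem_residueImage, mem_residueImage]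
  constructor
  · rintro ⟨a, ha, e⟩
    obtain ⟨a, rfl⟩ := residue_surjective a
    refine ⟨a, mem_composite.2 ⟨a.2, ha⟩, (residueFieldEquiv C).injective ?_⟩
    exact e
  · rintro ⟨a, ha, rfl⟩
    obtain ⟨h1, h2⟩ := mem_composite.1 ha
    exact ⟨residue _ ⟨a, h1⟩, h2, rfl⟩

/-- With `H = valueSubgroup K (composite C)`, the subgroup for `B₀` is `B₀ˣ H`. Its index in `Lˣ` is
the first factor, and `[B₀ˣ H : H] = [B₀ˣ : B₀ˣ ∩ H]` becomes the second one after reduction to the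
residue field. -/
theorem ramificationIndex_composite {B₀ : ValuationSubring L}
    (C : ValuationSubring (ResidueField B₀)) :
    ramificationIndex K (composite C) =
      ramificationIndex K B₀ * ramificationIndex (ResidueField (restrict K B₀)) C := by
  rw [ramificationIndex_eq_index, ramificationIndex_eq_index, ramificationIndex_eq_index]
  let φ : B₀ˣ →* Lˣ := Units.map (B₀.subtype : B₀ →* L)
  let ψ : B₀ˣ →* (ResidueField B₀)ˣ := Units.map (residue B₀ : B₀ →* ResidueField B₀)
  have hψ : Function.Surjective ψ := by
    intro y
    obtain ⟨x, hx⟩ := residue_surjective (y : ResidueField B₀)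
    obtain ⟨u, hu⟩ := (residue_ne_zero_iff_isUnit x).1 (by rw [hx]; exact y.ne_zero)
    exact ⟨u, Units.ext (by rw [← hx, ← hu]; rfl)⟩
  have h1 : (valueSubgroup (ResidueField (restrict K B₀)) C).comap ψ =
      (valueSubgroup K (composite C)).comap φ := by
    ext u
    rw [Subgroup.mem_comap, Subgroup.mem_comap, mem_valueSubgroup, mem_valueSubgroup]
    have key : ∀ a : (restrict K B₀)ˣ,
        (composite C).valuation (φ u) = (composite C).valuation (algebraMap K L (a : restrict K B₀))
          ↔ C.valuation (ψ u) = C.valuation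
            (algebraMap (ResidueField (restrict K B₀)) (ResidueField B₀) (residue _ a)) :=
      fun a => composite_valuation_eq_iff C u
        (Units.map (integersMap K B₀ : restrict K B₀ →* B₀) a)
    constructor
    · rintro ⟨y, hy⟩
      obtain ⟨a, ha⟩ := residue_surjective (y : ResidueField (restrict K B₀))
      obtain ⟨a, rfl⟩ := (residue_ne_zero_iff_isUnit a).1 (by rw [ha]; exact y.ne_zero)
      refine ⟨Units.map ((restrict K B₀).subtype : restrict K B₀ →* K) a, (key a).2 ?_⟩
      rw [hy, ← ha]
    · rintro ⟨a, ha⟩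
      have hu : B₀.valuation (φ u : L) = 1 := B₀.valuation_unit u
      have ha1 : B₀.valuation (algebraMap K L a) = B₀.valuation (algebraMap K L 1) := by
        rw [← valuation_eq_of_le (composite_le C) ha, hu, map_one, map_one]
      rw [← restrict_valuation_eq_iff, map_one] at ha1
      obtain ⟨b, hb⟩ := ((restrict K B₀).valuation_eq_one_iff
        ⟨a, ((restrict K B₀).valuation_le_one_iff _).1 ha1.le⟩).2 ha1
      have hba : ((b : restrict K B₀) : K) = a := by rw [hb]
      refine ⟨Units.map (residue (restrict K B₀) : restrict K B₀ →* ResidueField (restrict K B₀)) b, (key b).1 ?_⟩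
      rw [hba]
      exact ha
  have h2 : valueSubgroup K B₀ = φ.range ⊔ valueSubgroup K (composite C) := by
    apply le_antisymm
    · intro x hx
      obtain ⟨a, ha⟩ := mem_valueSubgroup.1 hx
      let a' : Lˣ := Units.map (algebraMap K L : K →* L) a
      have hxa : B₀.valuation ((x * a'⁻¹ : Lˣ) : L) = 1 := by
        rw [Units.val_mul, Units.val_inv_eq_inv_val, map_mul, map_inv₀, ha]
        exact mul_inv_cancel₀ (by simp)
      obtain ⟨b, hb⟩ := (B₀.valuation_eq_one_iff
        ⟨_, (B₀.valuation_le_one_iff _).1 hxa.le⟩).2 hxa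
      rw [← inv_mul_cancel_right x a']
      refine Subgroup.mul_mem_sup ⟨b, Units.ext ?_⟩ (mem_valueSubgroup.2 ⟨a, rfl⟩)
      change ((b : B₀) : L) = _
      rw [hb]
    · refine sup_le ?_ ?_
      · rintro _ ⟨u, rfl⟩
        refine mem_valueSubgroup.2 ⟨1, ?_⟩
        have hu : B₀.valuation (φ u : L) = 1 := B₀.valuation_unit u
        rw [hu, Units.val_one, map_one, map_one]
      · intro x hx
        obtain ⟨a, ha⟩ := mem_valueSubgroup.1 hx
        exact mem_valueSubgroup.2 ⟨a, valuation_eq_of_le (composite_le C) ha⟩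
  rw [← Subgroup.index_comap_of_surjective _ hψ, h1, Subgroup.index_comap, h2,
    ← Subgroup.relIndex_sup_right, mul_comm, Subgroup.relIndex_mul_index le_sup_right]

end

end Composition

/-! ### The defect formula descends to the residue field of the coarsening. -/

section DefectFormula

variable {K : Type u} [Field K]

/-- Equality holds in the fundamental inequality for the extension `L | K`. -/
def DefectFormula (A : ValuationSubring K) (L : Type u) [Field L] [Algebra K L] : Prop :=
  Module.finrank K L =
    ∑ᶠ B : {B : ValuationSubring L // restrict K B = A},
      ramificationIndex K B.1 * inertiaDegree K B.1

/-- A coarsening of the restriction of `B` is the restriction of a coarsening of `B`. -/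
theorem exists_coarsening {L : Type u} [Field L] [Algebra K L] (B : ValuationSubring L)
    {A₀ : ValuationSubring K} (h : restrict K B ≤ A₀) :
    ∃ B₀ : ValuationSubring L, B ≤ B₀ ∧ restrict K B₀ = A₀ := by
  -- In terms of values this is a convex hull: the elements of `L` bounded by an element of `A₀`.
  let S : Subring L :=
    { carrier := {x | ∃ a ∈ A₀, B.valuation x ≤ B.valuation (algebraMap K L a)}
      zero_mem' := ⟨0, A₀.zero_mem, by simp⟩
      one_mem' := ⟨1, A₀.one_mem, by simp⟩
      add_mem' := by
        rintro x y ⟨a, ha, hxa⟩ ⟨b, hb, hyb⟩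
        rcases le_total (B.valuation (algebraMap K L a)) (B.valuation (algebraMap K L b)) with h | h
        · exact ⟨b, hb, B.valuation.map_add_le (hxa.trans h) hyb⟩
        · exact ⟨a, ha, B.valuation.map_add_le hxa (hyb.trans h)⟩
      neg_mem' := by
        rintro x ⟨a, ha, hxa⟩
        exact ⟨a, ha, by rwa [Valuation.map_neg]⟩
      mul_mem' := by
        rintro x y ⟨a, ha, hxa⟩ ⟨b, hb, hyb⟩
        refine ⟨a * b, mul_mem ha hb, ?_⟩
        rw [map_mul, map_mul, map_mul]
        exact mul_le_mul' hxa hyb }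
  have hS : B.toSubring ≤ S := fun x hx =>
    ⟨1, A₀.one_mem, by simpa using (B.valuation_le_one_iff x).2 hx⟩
  refine ⟨B.ofLE S hS, hS, ?_⟩
  ext x
  constructor
  · rintro ⟨a, ha, hxa⟩
    rw [← restrict_valuation_le_iff, ValuationSubring.valuation_le_iff] at hxa
    obtain ⟨c, rfl⟩ := hxa
    exact mul_mem (h c.2) ha
  · intro hx
    exact ⟨x, hx, le_rfl⟩

section

attribute [local instance] residueAlgebra

variable {L : Type u} [Field L] [Algebra K L]

theorem restrict_residueValuation {B B₀ : ValuationSubring L} (h : B ≤ B₀)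
    (h' : restrict K B ≤ restrict K B₀) :
    restrict (ResidueField (restrict K B₀)) (residueValuation h) = residueValuation h' := by
  apply composite_injective
  rw [← restrict_composite, composite_residueValuation, composite_residueValuation]

/-- If `v₀` extends uniquely to `L` and without defect, the defect formula for the extension `L | K`
with respect to `v₀ ∘ v₁` is the one for its residue extension with respect to `v₁`. -/
theorem defectFormula_iff_residue [FiniteDimensional K L] {B₀ : ValuationSubring L}
    (h₀ : IsUniqueDefectless (restrict K B₀)) {A : ValuationSubring K}
    (hA : A ≤ restrict K B₀) :
    DefectFormula A L ↔ DefectFormula (residueValuation hA) (ResidueField B₀) := by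
  -- Any extension of `A` has a coarsening over `restrict K B₀`, which uniqueness identifies with
  -- `B₀`; so every extension is a composite.
  have hle : ∀ B : ValuationSubring L, restrict K B = A → B ≤ B₀ := by
    rintro B rfl
    obtain ⟨B₁, hB, h1⟩ := exists_coarsening B hA
    rwa [h₀.1 L B₁ B₀ h1 rfl] at hB
  have hsum : ∑ᶠ B : {B : ValuationSubring L // restrict K B = A},
      ramificationIndex K B.1 * inertiaDegree K B.1 =
      ∑ᶠ C : {C : ValuationSubring (ResidueField B₀) //
        restrict (ResidueField (restrict K B₀)) C = residueValuation hA},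
        ramificationIndex K B₀ * (ramificationIndex (ResidueField (restrict K B₀)) C.1 *
          inertiaDegree (ResidueField (restrict K B₀)) C.1) := by
    symm
    refine finsum_eq_of_bijective (fun C => ⟨composite C.1, ?_⟩) ⟨?_, ?_⟩ fun C => ?_
    · rw [restrict_composite, C.2, composite_residueValuation]
    · intro C C' h
      exact Subtype.ext (composite_injective (congrArg Subtype.val h))
    · rintro ⟨B, hB⟩
      have hB0 := hle B hB
      subst hB
      exact ⟨⟨residueValuation hB0, restrict_residueValuation hB0 hA⟩,
        Subtype.ext (composite_residueValuation hB0)⟩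
    · rw [ramificationIndex_composite, inertiaDegree_composite, mul_assoc]
  rw [DefectFormula, DefectFormula, hsum, ← mul_finsum, h₀.finrank_eq]
  exact mul_right_inj' (fundamental_inequality B₀).1

theorem finiteDimensional_residueField [FiniteDimensional K L] (B : ValuationSubring L) :
    FiniteDimensional (ResidueField (restrict K B)) (ResidueField B) :=
  Module.finite_of_finrank_pos (Nat.pos_of_ne_zero (fundamental_inequality B).2.1)

/-- Scale the minimal polynomial of a lift by its coefficient of largest value: it becomes integral
with one coefficient equal to `1`, so its reduction is a nonzero polynomial killing the residue. -/
theorem isAlgebraic_residueField [Algebra.IsAlgebraic K L] (B : ValuationSubring L) :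
    Algebra.IsAlgebraic (ResidueField (restrict K B)) (ResidueField B) := by
  refine ⟨fun y => ?_⟩
  obtain ⟨x, rfl⟩ := residue_surjective y
  have hint : IsIntegral K (x : L) := Algebra.IsIntegral.isIntegral _
  set p := minpoly K (x : L) with hp
  obtain ⟨j, hj, hmax⟩ := (Finset.range (p.natDegree + 1)).exists_max_image
    (fun i => (restrict K B).valuation (p.coeff i)) ⟨0, by simp⟩
  have hlead : (restrict K B).valuation (p.coeff j) ≠ 0 := by
    have := hmax p.natDegree (by simp)
    rw [Polynomial.coeff_natDegree, (minpoly.monic hint).leadingCoeff, map_one] at this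
    exact (zero_lt_one.trans_le this).ne'
  have hj0 : p.coeff j ≠ 0 := by simpa using hlead
  have hmax' : ∀ i, (restrict K B).valuation (p.coeff i) ≤ (restrict K B).valuation (p.coeff j) := by
    intro i
    by_cases hi : i < p.natDegree + 1
    · exact hmax i (Finset.mem_range.2 hi)
    · rw [Polynomial.coeff_eq_zero_of_natDegree_lt (by omega), map_zero]
      exact zero_le
  have hl : Polynomial.C (p.coeff j)⁻¹ * p ∈ Polynomial.lifts (algebraMap (restrict K B) K) := by
    rw [Polynomial.lifts_iff_coeff_lifts]
    intro i
    refine ⟨⟨(p.coeff j)⁻¹ * p.coeff i, ?_⟩, by rw [Polynomial.coeff_C_mul]; rfl⟩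
    rw [← ValuationSubring.valuation_le_one_iff, map_mul, map_inv₀, mul_comm, ← div_eq_mul_inv,
      div_le_one₀ (zero_lt_iff.2 hlead)]
    exact hmax' i
  obtain ⟨q, hq⟩ := hl
  have hq' : q.map (algebraMap (restrict K B) K) = Polynomial.C (p.coeff j)⁻¹ * p := hq
  refine ⟨q.map (residue _), fun h => ?_, ?_⟩
  · have h1 := congrArg (fun r => Polynomial.coeff r j) hq'
    have h2 := congrArg (fun r => Polynomial.coeff r j) h
    simp only [Polynomial.coeff_map, Polynomial.coeff_C_mul, inv_mul_cancel₀ hj0,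
      Polynomial.coeff_zero] at h1 h2
    rw [show q.coeff j = 1 from Subtype.ext h1, map_one] at h2
    exact one_ne_zero h2
  · have h1 : q.eval₂ (integersMap K B) x = 0 := by
      apply Subtype.ext
      have h2 := Polynomial.hom_eval₂ q (integersMap K B) B.subtype x
      have h3 : B.subtype.comp (integersMap K B) =
          (algebraMap K L).comp (algebraMap (restrict K B) K) := rfl
      rw [h3, ← Polynomial.eval₂_map, hq', Polynomial.eval₂_mul] at h2
      have h4 : Polynomial.eval₂ (algebraMap K L) (B.subtype x) p = 0 := minpoly.aeval K (x : L)
      rw [h4, mul_zero] at h2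
      exact h2
    rw [Polynomial.aeval_def, Polynomial.eval₂_map]
    have h2 := Polynomial.hom_eval₂ q (integersMap K B) (residue B) x
    rw [h1, map_zero] at h2
    exact h2.symm

end

end DefectFormula

/-! ### Invariance of the defect formula under isomorphism. -/

section Transport

variable {K L : Type u} [Field K] [Field L] [Algebra K L]

theorem ramificationIndex_eq_one_of_bijective (h : Function.Bijective (algebraMap K L))
    (B : ValuationSubring L) : ramificationIndex K B = 1 := by
  rw [ramificationIndex_eq_index, Subgroup.index_eq_one]
  refine eq_top_iff.2 fun x _ => mem_valueSubgroup.2 ?_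
  obtain ⟨a, ha⟩ := h.2 x
  exact ⟨Units.mk0 a (by rintro rfl; exact x.ne_zero (by rw [← ha, map_zero])), by simp [ha]⟩

theorem inertiaDegree_eq_one_of_bijective (h : Function.Bijective (algebraMap K L))
    (B : ValuationSubring L) : inertiaDegree K B = 1 := by
  have htop : residueImage K B = ⊤ := by
    refine eq_top_iff.2 fun y _ => mem_residueImage.2 ?_
    obtain ⟨⟨x, hx⟩, rfl⟩ := residue_surjective y
    obtain ⟨a, rfl⟩ := h.2 x
    exact ⟨a, hx, rfl⟩
  rw [inertiaDegree_eq_finrank, htop, ← Subfield.relfinrank_top_right, Subfield.relfinrank_self]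

theorem finrank_eq_one_of_bijective (h : Function.Bijective (algebraMap K L)) :
    Module.finrank K L = 1 := by
  rw [← (LinearEquiv.ofBijective (Algebra.linearMap K L) h).finrank_eq, Module.finrank_self]

theorem restrict_injective_of_bijective (h : Function.Bijective (algebraMap K L)) :
    Function.Injective (restrict K : ValuationSubring L → ValuationSubring K) := by
  intro B B' hB
  ext x
  obtain ⟨a, rfl⟩ := h.2 x
  rw [← mem_restrict, hB, mem_restrict]

/-- Needed because the lifting results realize a given extension as a residue field only up to
isomorphism. A bijective step has degree, `e` and `f` equal to `1`, so the tower formulas give the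
claim. -/
theorem defectFormula_congr {K' L' : Type u} [Field K'] [Field L'] [Algebra K K'] [Algebra K' L']
    [Algebra L L'] [Algebra K L'] [IsScalarTower K K' L'] [IsScalarTower K L L']
    (hK : Function.Bijective (algebraMap K K')) (hL : Function.Bijective (algebraMap L L'))
    (A' : ValuationSubring K') : DefectFormula (restrict K A') L ↔ DefectFormula A' L' := by
  have hdeg : Module.finrank K L = Module.finrank K' L' := by
    have h1 := Module.finrank_mul_finrank K L L'
    rw [← Module.finrank_mul_finrank K K' L', finrank_eq_one_of_bijective hK,
      finrank_eq_one_of_bijective hL, mul_one, one_mul] at h1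
    exact h1
  have hsum : ∑ᶠ B : {B : ValuationSubring L' // restrict K' B = A'},
      ramificationIndex K' B.1 * inertiaDegree K' B.1 =
      ∑ᶠ B : {B : ValuationSubring L // restrict K B = restrict K A'},
      ramificationIndex K B.1 * inertiaDegree K B.1 := by
    refine finsum_eq_of_bijective (fun B => ⟨restrict L B.1, ?_⟩) ⟨?_, ?_⟩ fun B => ?_
    · rw [restrict_restrict, ← restrict_restrict (L := K'), B.2]
    · intro B B' h
      exact Subtype.ext (restrict_injective_of_bijective hL (congrArg Subtype.val h))
    · rintro ⟨B, hB⟩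
      obtain ⟨B', rfl⟩ := exists_restrict_eq L' B
      refine ⟨⟨B', restrict_injective_of_bijective hK ?_⟩, rfl⟩
      rw [restrict_restrict, ← hB, restrict_restrict]
    · have h1 := ramificationIndex_tower (K := K) (L := L) B.1
      have h2 := inertiaDegree_tower (K := K) (L := L) B.1
      rw [ramificationIndex_tower (L := K'), ramificationIndex_eq_one_of_bijective hK,
        ramificationIndex_eq_one_of_bijective hL, mul_one, one_mul] at h1
      rw [inertiaDegree_tower (L := K'), inertiaDegree_eq_one_of_bijective hK,
        inertiaDegree_eq_one_of_bijective hL, mul_one, one_mul] at h2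
      rw [h1, h2]
  rw [DefectFormula, DefectFormula, hdeg, hsum]

end Transport

/-! ### Realizing extensions of the residue field. -/

section Lifting

variable {K Ω : Type u} [Field K] [Field Ω] [Algebra K Ω]

theorem exists_root_residue_eq [IsAlgClosed Ω] (W : ValuationSubring Ω) {q : Polynomial W}
    (hq : q.Monic) {y : ResidueField W} (hy : (q.map (residue W)).eval y = 0) :
    ∃ x : W, q.eval x = 0 ∧ residue W x = y := by
  obtain ⟨z, rfl⟩ := residue_surjective y
  rw [Polynomial.eval_map_apply, residue_eq_zero_iff_valuation] at hy
  set Q := q.map (algebraMap W Ω) with hQ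
  have hQm : Q.Monic := hq.map _
  have hev : ∀ x : W, Q.eval (x : Ω) = (q.eval x : W) := fun x =>
    Polynomial.eval_map_apply (algebraMap W Ω) x
  rw [← hev, (IsAlgClosed.splits Q).eval_eq_prod_roots_of_monic hQm, map_multiset_prod,
    Multiset.map_map] at hy
  -- The value of the polynomial at `z` is a product of differences from the roots; it is small, so
  -- some root is congruent to `z`.
  obtain ⟨r, hr, hlt⟩ : ∃ r ∈ Q.roots, W.valuation (z - r) < 1 := by
    by_contra! hcon
    refine not_lt_of_ge (Multiset.one_le_prod_of_one_le fun a ha => ?_) hy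
    obtain ⟨r, hr, rfl⟩ := Multiset.mem_map.1 ha
    exact hcon r hr
  have hrW : r ∈ W := by
    have h1 := (W.valuation_le_one_iff _).1 hlt.le
    simpa using sub_mem z.2 h1
  refine ⟨⟨r, hrW⟩, Subtype.ext ?_, ?_⟩
  · rw [← hev]
    exact (Polynomial.mem_roots hQm.ne_zero).1 hr
  · rw [residue_eq_residue_iff, Valuation.map_sub_swap]
    exact hlt

theorem isAlgClosed_residueField [IsAlgClosed Ω] (W : ValuationSubring Ω) :
    IsAlgClosed (ResidueField W) := by
  refine IsAlgClosed.of_exists_root _ fun p hp hirr => ?_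
  have hl : p ∈ Polynomial.lifts (residue W) :=
    Polynomial.mem_lifts_of_surjective residue_surjective p
  obtain ⟨q, rfl, hdeg, hqm⟩ := Polynomial.lifts_and_natDegree_eq_and_monic hl hp
  have hd : (q.map (algebraMap W Ω)).degree ≠ 0 := by
    rw [hqm.degree_map, Polynomial.degree_eq_natDegree hqm.ne_zero, hdeg]
    exact_mod_cast hirr.natDegree_pos.ne'
  obtain ⟨x, hx⟩ := IsAlgClosed.exists_root _ hd
  have hxW : x ∈ W := mem_of_monic_of_eval_eq_zero W (hqm.map _) (fun i => by
    rw [Polynomial.coeff_map]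
    exact (q.coeff i).2) hx
  refine ⟨residue W ⟨x, hxW⟩, ?_⟩
  have h1 : (q.map (algebraMap W Ω)).eval x = (q.eval ⟨x, hxW⟩ : W) :=
    Polynomial.eval_map_apply (algebraMap W Ω) ⟨x, hxW⟩
  rw [hx] at h1
  rw [Polynomial.eval_map_apply, show q.eval ⟨x, hxW⟩ = 0 from Subtype.ext h1.symm, map_zero]

theorem residueImage_mono {M M' : IntermediateField K Ω} (h : M ≤ M') (W : ValuationSubring Ω) :
    residueImage M W ≤ residueImage M' W := by
  intro y hy
  obtain ⟨a, ha, rfl⟩ := mem_residueImage.1 hy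
  exact mem_residueImage.2 ⟨⟨a, h a.2⟩, ha, rfl⟩

/-- Adjoining a lift of a residue `y` that is algebraic over the residue field. -/
theorem exists_adjoin_residue [IsAlgClosed Ω] (W : ValuationSubring Ω) (M : IntermediateField K Ω)
    {y : ResidueField W} (hy : IsIntegral (residueImage M W) y) {F : Subfield (ResidueField W)}
    (hF : residueImage M W ≤ F) (hyF : y ∈ F) :
    ∃ M' : IntermediateField K Ω, M ≤ M' ∧ y ∈ residueImage M' W ∧ residueImage M' W ≤ F := by
  let R := residueImage M W
  let θ : restrict M W →+* R := ((residue W).comp (integersMap M W)).codRestrict R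
    fun a => mem_residueImage.2 ⟨a, a.2, rfl⟩
  have hθ : Function.Surjective θ := by
    rintro ⟨z, hz⟩
    obtain ⟨a, ha, rfl⟩ := mem_residueImage.1 hz
    exact ⟨⟨a, ha⟩, rfl⟩
  -- Lifting the minimal polynomial of `y` with the same degree `n` bounds the degree of the root
  -- `x` over `M` by `n`, so powers below `n` span `M(x)` and their residues are independent.
  obtain ⟨f, hf, hdeg, hfm⟩ := Polynomial.lifts_and_natDegree_eq_and_monic
    (Polynomial.mem_lifts_of_surjective hθ (minpoly R y)) (minpoly.monic hy)
  obtain ⟨x, hx, rfl⟩ := exists_root_residue_eq W (q := f.map (integersMap M W)) (hfm.map _)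
    (y := y) (by
      rw [Polynomial.map_map, show (residue W).comp (integersMap M W) =
        (algebraMap R (ResidueField W)).comp θ from rfl, ← Polynomial.map_map, hf,
        Polynomial.eval_map_algebraMap, minpoly.aeval])
  set g : Polynomial M := f.map (algebraMap (restrict M W) M) with hg
  have hgm : g.Monic := hfm.map _
  have hgdeg : g.natDegree = (minpoly R (residue W x)).natDegree := by
    rw [hg, hfm.natDegree_map, hdeg]
  have hgx : Polynomial.aeval (x : Ω) g = 0 := by
    have h1 : (f.map (integersMap M W)).map (algebraMap W Ω) = g.map (algebraMap M Ω) := by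
      rw [hg, Polynomial.map_map, Polynomial.map_map]
      rfl
    rw [← Polynomial.eval_map_algebraMap, ← h1]
    have h2 : ((f.map (integersMap M W)).map (algebraMap W Ω)).eval (x : Ω) =
      ((f.map (integersMap M W)).eval x : W) := Polynomial.eval_map_apply (algebraMap W Ω) x
    rw [h2, hx]
    rfl
  have hxint : IsIntegral M (x : Ω) := ⟨g, hgm, hgx⟩
  let M' : IntermediateField M Ω := IntermediateField.adjoin M {(x : Ω)}
  refine ⟨M'.restrictScalars K, fun a ha => M'.algebraMap_mem ⟨a, ha⟩, ?_, ?_⟩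
  · exact mem_residueImage.2
      ⟨⟨x, IntermediateField.mem_adjoin_simple_self M (x : Ω)⟩, x.2, rfl⟩
  · intro z hz
    obtain ⟨⟨a, ha⟩, haW, rfl⟩ := mem_residueImage.1 hz
    have ha' : a ∈ Algebra.adjoin M {(x : Ω)} := by
      rw [← IntermediateField.adjoin_simple_toSubalgebra_of_isAlgebraic hxint.isAlgebraic]
      exact ha
    obtain ⟨p, hp⟩ := Algebra.adjoin_mem_exists_aeval M (x : Ω) ha'
    set n := (minpoly R (residue W x)).natDegree with hn
    have hn0 : 0 < n := minpoly.natDegree_pos hy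
    have hpn : (p %ₘ g).natDegree < n := by
      rw [← hgdeg]
      refine Polynomial.natDegree_modByMonic_lt p hgm fun h1 => ?_
      rw [h1, Polynomial.natDegree_one] at hgdeg
      omega
    have hsum : a = ∑ i : Fin n, (p %ₘ g).coeff i • ((x ^ (i : ℕ) : W) : Ω) := by
      rw [← hp, ← Polynomial.aeval_modByMonic_eq_self_of_root hgx,
        Polynomial.aeval_eq_sum_range' hpn, Finset.sum_range]
      rfl
    have hne : Nonempty (Fin n) := ⟨⟨0, hn0⟩⟩
    obtain ⟨j, hj, hmax⟩ := Finset.univ.exists_max_image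
      (fun i : Fin n => W.valuation (algebraMap M Ω ((p %ₘ g).coeff i))) Finset.univ_nonempty
    -- By independence of the residues, integrality of the sum forces every coefficient to be
    -- integral; its residue is thus a polynomial in `y` over the residue field of `M`.
    have hval := valuation_sum_smul W (fun i : Fin n => x ^ (i : ℕ)) (by
      simp only [map_pow]
      exact linearIndependent_pow (K := R) (residue W x)) Finset.univ
      (fun i => (p %ₘ g).coeff i) hj hmax
    rw [← hsum] at hval
    have hcW : ∀ i : Fin n, algebraMap M Ω ((p %ₘ g).coeff i) ∈ W := by
      intro i
      rw [← ValuationSubring.valuation_le_one_iff]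
      refine (hmax i (Finset.mem_univ i)).trans ?_
      rw [← hval, ValuationSubring.valuation_le_one_iff]
      exact haW
    have hsumW : (⟨a, haW⟩ : W) = ∑ i : Fin n, ⟨_, hcW i⟩ * x ^ (i : ℕ) := by
      apply Subtype.ext
      rw [AddSubmonoidClass.coe_finsetSum]
      exact hsum
    change residue W ⟨a, haW⟩ ∈ F
    rw [hsumW, map_sum]
    refine sum_mem fun i _ => ?_
    rw [map_mul, map_pow]
    exact mul_mem (hF (mem_residueImage.2 ⟨_, hcW i, rfl⟩)) (pow_mem hyF _)

/-- By Zorn there is an `M` maximal with residue field inside `F`; a missing element of `F` could be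
adjoined by `exists_adjoin_residue`. -/
theorem exists_residueImage_eq [IsAlgClosed Ω] (W : ValuationSubring Ω)
    (F : Subfield (ResidueField W)) (hF : residueImage K W ≤ F)
    (halg : ∀ y ∈ F, IsIntegral (residueImage K W) y) :
    ∃ M : IntermediateField K Ω, residueImage M W = F := by
  have hK : ∀ M : IntermediateField K Ω, residueImage K W ≤ residueImage M W := by
    intro M y hy
    obtain ⟨a, ha, rfl⟩ := mem_residueImage.1 hy
    exact mem_residueImage.2 ⟨algebraMap K M a, ha, rfl⟩
  obtain ⟨M, hM⟩ := zorn_le₀ {M : IntermediateField K Ω | residueImage M W ≤ F} (by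
    intro c hc hchain
    rcases c.eq_empty_or_nonempty with rfl | hne
    · refine ⟨⊥, ?_, by simp⟩
      intro y hy
      obtain ⟨⟨a, ha'⟩, ha, rfl⟩ := mem_residueImage.1 hy
      obtain ⟨b, rfl⟩ := IntermediateField.mem_bot.1 ha'
      exact hF (mem_residueImage.2 ⟨b, ha, rfl⟩)
    · have : Nonempty c := hne.to_subtype
      refine ⟨⨆ i : c, i.1, ?_, fun M hM => le_iSup (fun i : c => i.1) ⟨M, hM⟩⟩
      intro y hy
      obtain ⟨⟨a, ha'⟩, ha, rfl⟩ := mem_residueImage.1 hy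
      have ha2 : a ∈ ((⨆ i : c, i.1 : IntermediateField K Ω) : Set Ω) := ha'
      rw [IntermediateField.coe_iSup_of_directed hchain.directed] at ha2
      obtain ⟨i, hi⟩ := Set.mem_iUnion.1 ha2
      exact hc i.2 (mem_residueImage.2 ⟨⟨a, hi⟩, ha, rfl⟩))
  refine ⟨M, le_antisymm hM.prop fun y hy => ?_⟩
  have hint : IsIntegral (residueImage M W) y := by
    obtain ⟨p, hp, hpy⟩ := halg y hy
    exact ⟨p.map (Subfield.inclusion (hK M)), hp.map _, by rw [Polynomial.eval₂_map]; exact hpy⟩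
  obtain ⟨M', hle, hyMem, hM'⟩ := exists_adjoin_residue W M hint hM.prop hy
  exact residueImage_mono (hM.le_of_ge hM' hle) W hyMem

/-- Every algebraic extension of the residue field is the residue field of an algebraic extension. -/
theorem exists_algebraic_lift (A₀ : ValuationSubring K) (E : Type u) [Field E]
    [Algebra (ResidueField A₀) E] [Algebra.IsAlgebraic (ResidueField A₀) E] :
    ∃ (L : Type u) (_ : Field L) (_ : Algebra K L) (_ : Algebra.IsAlgebraic K L)
      (B : ValuationSubring L) (_ : restrict K B = A₀) (j : ResidueField B →+* E),
      Function.Bijective j ∧ ∀ (a : K) (ha : a ∈ A₀) (hb : algebraMap K L a ∈ B),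
        j (residue B ⟨algebraMap K L a, hb⟩) = algebraMap (ResidueField A₀) E (residue A₀ ⟨a, ha⟩) := by
  obtain ⟨W, rfl⟩ := exists_restrict_eq (AlgebraicClosure K) A₀
  let := residueAlgebra K W
  have := isAlgClosed_residueField W
  -- The residue field of the algebraic closure is algebraically closed, so it contains a copy of
  -- `E`, to be realized by an intermediate field.
  let ι : E →ₐ[ResidueField (restrict K W)] ResidueField W := IsAlgClosed.lift
  have hFK : residueImage K W ≤ (ι : E →+* ResidueField W).fieldRange := by
    rintro _ ⟨z, rfl⟩
    exact ⟨algebraMap _ E z, ι.commutes z⟩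
  obtain ⟨M, hM⟩ := exists_residueImage_eq (K := K) W (ι : E →+* ResidueField W).fieldRange hFK (by
    rintro _ ⟨e, rfl⟩
    obtain ⟨p, hp, hpe⟩ := Algebra.IsIntegral.isIntegral (R := ResidueField (restrict K W)) e
    let θ : ResidueField (restrict K W) →+* residueImage K W :=
      (ResidueField.map (integersMap K W)).rangeRestrictField
    refine ⟨p.map θ, hp.map _, ?_⟩
    rw [Polynomial.eval₂_map]
    have h1 := Polynomial.hom_eval₂ p (algebraMap _ E) (ι : E →+* ResidueField W) e
    rw [hpe, map_zero, AlgHom.comp_algebraMap_of_tower] at h1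
    exact h1.symm)
  let ρ := ResidueField.map (integersMap M W)
  have hρ : ∀ z, ρ z ∈ (ι : E →+* ResidueField W).fieldRange := fun z => by
    rw [← hM]
    exact ⟨z, rfl⟩
  let e : E ≃+* (ι : E →+* ResidueField W).fieldRange :=
    RingEquiv.ofBijective (ι : E →+* ResidueField W).rangeRestrictField
      (ι : E →+* ResidueField W).rangeRestrictField_bijective
  let j : ResidueField (restrict M W) →+* E :=
    (e.symm : _ →+* E).comp (ρ.codRestrict (ι : E →+* ResidueField W).fieldRange hρ)
  have hj : ∀ z, ι (j z) = ρ z := fun z =>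
    congrArg Subtype.val (e.apply_symm_apply ⟨ρ z, hρ z⟩)
  refine ⟨M, inferInstance, inferInstance, inferInstance, restrict M W, restrict_restrict W, j,
    ⟨j.injective, fun x => ?_⟩, fun a ha hb => ?_⟩
  · obtain ⟨z, hz⟩ : ι x ∈ residueImage M W := by
      rw [hM]
      exact ⟨x, rfl⟩
    exact ⟨z, ι.toRingHom.injective ((hj z).trans hz)⟩
  · apply ι.toRingHom.injective
    refine (hj _).trans ?_
    refine Eq.trans ?_ (ι.commutes _).symm
    rfl

/-- Inside an algebraic lift, adjoin to `K` lifts of a basis of `E`. The residue field of the result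
lies between the subfield generated by that basis and `E`, so it is all of `E`. -/
theorem exists_finite_lift (A₀ : ValuationSubring K) (E : Type u) [Field E]
    [Algebra (ResidueField A₀) E] [FiniteDimensional (ResidueField A₀) E] :
    ∃ (L : Type u) (_ : Field L) (_ : Algebra K L) (_ : FiniteDimensional K L)
      (B : ValuationSubring L) (_ : restrict K B = A₀) (j : ResidueField B →+* E),
      Function.Bijective j ∧ ∀ (a : K) (ha : a ∈ A₀) (hb : algebraMap K L a ∈ B),
        j (residue B ⟨algebraMap K L a, hb⟩) = algebraMap (ResidueField A₀) E (residue A₀ ⟨a, ha⟩) := by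
  obtain ⟨L, _, _, _, B, rfl, j, hj, hjK⟩ := exists_algebraic_lift A₀ E
  let b := Module.finBasis (ResidueField (restrict K B)) E
  have hb : ∀ i, ∃ x : B, j (residue B x) = b i := fun i => by
    obtain ⟨y, hy⟩ := hj.2 (b i)
    obtain ⟨x, rfl⟩ := residue_surjective y
    exact ⟨x, hy⟩
  choose x hx using hb
  let M := IntermediateField.adjoin K (Set.range fun i => (x i : L))
  have hfin : FiniteDimensional K M := by
    have : Finite (Set.range fun i => (x i : L)) := inferInstance
    exact IntermediateField.finiteDimensional_adjoin fun y _ => Algebra.IsIntegral.isIntegral y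
  let j' : ResidueField (restrict M B) →+* E := j.comp (ResidueField.map (integersMap M B))
  have hK : ∀ a, algebraMap (ResidueField (restrict K B)) E a ∈ j'.fieldRange := by
    intro a
    obtain ⟨a, rfl⟩ := residue_surjective a
    exact ⟨residue (restrict M B) ⟨algebraMap K M a, a.2⟩, hjK a a.2 a.2⟩
  have hbj : ∀ i, b i ∈ j'.fieldRange := fun i =>
    ⟨residue (restrict M B) ⟨⟨x i, IntermediateField.subset_adjoin K _ ⟨i, rfl⟩⟩, (x i).2⟩, hx i⟩
  refine ⟨M, inferInstance, inferInstance, hfin, restrict M B, restrict_restrict B, j',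
    ⟨j'.injective, fun z => ?_⟩, fun a ha hb => hjK a ha hb⟩
  change z ∈ j'.fieldRange
  rw [← b.sum_repr z]
  refine sum_mem fun i _ => ?_
  rw [Algebra.smul_def]
  exact mul_mem (hK _) (hbj i)

end Lifting

/-! ### The two equivalences for a general coarsening. -/

section Main

attribute [local instance] residueAlgebra

variable {K : Type u} [Field K]

/-- Defectlessness of `v₀ ∘ v₁` is equivalent to defectlessness of `v₁`. -/
theorem isDefectlessField_iff_residueValuation {A A₀ : ValuationSubring K}
    (h₀ : IsUniqueDefectless A₀) (hA : A ≤ A₀) :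
    IsDefectlessField A ↔ IsDefectlessField (residueValuation hA) := by
  constructor
  · intro h E _ _ _
    obtain ⟨L, _, _, _, B, rfl, j, hj, hjK⟩ := exists_finite_lift A₀ E
    let : Algebra (ResidueField B) E := j.toAlgebra
    have : IsScalarTower (ResidueField (restrict K B)) (ResidueField B) E := by
      refine IsScalarTower.of_algebraMap_eq fun x => ?_
      obtain ⟨x, rfl⟩ := residue_surjective x
      exact (hjK x x.2 x.2).symm
    have h1 := (defectFormula_iff_residue h₀ hA).1 (h L)
    exact (defectFormula_congr (K := ResidueField (restrict K B)) (L := ResidueField B)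
      Function.bijective_id hj (residueValuation hA)).1 h1
  · intro h L _ _ _
    obtain ⟨B, rfl⟩ := exists_restrict_eq L A₀
    have := finiteDimensional_residueField (K := K) B
    exact (defectFormula_iff_residue h₀ hA).2 (h (ResidueField B))

theorem isDefectlessField_of_restrict_of_bijective {L : Type u} [Field L] [Algebra K L]
    (hL : Function.Bijective (algebraMap K L)) {B : ValuationSubring L}
    (h : IsDefectlessField (restrict K B)) : IsDefectlessField B := by
  intro M _ _ _
  let : Algebra K M := ((algebraMap L M).comp (algebraMap K L)).toAlgebra
  have : IsScalarTower K L M := IsScalarTower.of_algebraMap_eq' rfl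
  have : FiniteDimensional K L := Module.Finite.of_surjective (Algebra.linearMap K L) hL.2
  have : FiniteDimensional K M := Module.Finite.trans L M
  exact (defectFormula_congr (K := K) (L := M) hL Function.bijective_id B).1 (h M)

theorem allAlgebraicExtensionsDefectless_iff_residueValuation {A A₀ : ValuationSubring K}
    (h₀ : IsUniqueDefectless A₀) (hA : A ≤ A₀) :
    AllAlgebraicExtensionsDefectless A ↔
      AllAlgebraicExtensionsDefectless (residueValuation hA) := by
  constructor
  · intro h E _ _ _ C' hC'
    obtain ⟨L, _, _, _, B, rfl, j, hj, hjK⟩ := exists_algebraic_lift A₀ E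
    let : Algebra (ResidueField B) E := j.toAlgebra
    have : IsScalarTower (ResidueField (restrict K B)) (ResidueField B) E := by
      refine IsScalarTower.of_algebraMap_eq fun x => ?_
      obtain ⟨x, rfl⟩ := residue_surjective x
      exact (hjK x x.2 x.2).symm
    -- The valuation on `E`, transported to the residue field of `L` and composed with `B`, extends
    -- `A`; the first equivalence over `L` then applies.
    let C := restrict (ResidueField B) C'
    have hC : restrict K (composite C) = A := by
      rw [restrict_composite, restrict_restrict, hC', composite_residueValuation]
    have h1 := (isDefectlessField_iff_residueValuation h₀.of_restrict (composite_le C)).1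
      (h L (composite C) hC)
    rw [residueValuation_composite] at h1
    exact isDefectlessField_of_restrict_of_bijective hj h1
  · rintro h L _ _ _ B rfl
    obtain ⟨B₀, hB, rfl⟩ := exists_coarsening B hA
    have := isAlgebraic_residueField (K := K) B₀
    exact (isDefectlessField_iff_residueValuation h₀.of_restrict hB).2
      (h (ResidueField B₀) (residueValuation hB) (restrict_residueValuation hB hA))

end Main

end ValuedField

end

theorem mainTheorem5 {K : Type u} [Field K] (A : ValuationSubring K) [HenselianLocalRing A] :
    (ValuedField.IsDefectlessField A ↔
      ValuedField.IsDefectlessField (ValuedField.coreValuation A)) ∧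
    (ValuedField.AllAlgebraicExtensionsDefectless A ↔
      ValuedField.AllAlgebraicExtensionsDefectless (ValuedField.coreValuation A)) := by
  have h₀ := ValuedField.isUniqueDefectless_coreCoarsening A
  rw [ValuedField.coreValuation_eq]
  exact ⟨ValuedField.isDefectlessField_iff_residueValuation h₀ (ValuedField.le_coreCoarsening A),
    ValuedField.allAlgebraicExtensionsDefectless_iff_residueValuation h₀
      (ValuedField.le_coreCoarsening A)⟩
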